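/- **Setting.** Let $d\ge 2$. For $n_1,\dots,n_d\in\mathbb N$ let $K_{n_1,\dots,n_d}$ be the complete $d$-partite hypergraph with totally ordered color classes $[n_1],\dots,[n_d]$ and edge set $[n_1]\times\dots\times[n_d]$; write $K_n^{(d)}$ if all $n_i=n$. Edges are ordered coordinatewise. A *non-crossing hyper-matching* is a set of pairwise node-disjoint edges (distinct edges differ in every coordinate) that are pairwise comparable; $L(H)$ is the largest size of a non-crossing hyper-matching contained in $H\subseteq K_{n_1,\dots,n_d}$. For $A'_i\subseteq[n_i]$, $H|_{A'_1\times\dots\times A'_d}$ is the induced hyper-subgraph, regarded as a hyper-subgraph of $K_{|A'_1|,\dots,|A'_d|}$ via the order isomorphisms $A'_i\cong[|A'_i|]$. A *random $d$-partite hypergraph model* is a family of probability distributions $\mathcal D(K_{n_1,\dots,n_d})$ on the hyper-subgraphs of $K_{n_1,\dots,n_d}$ (one for each $(n_1,\dots,n_d)$) such that, for $H$ distributed according to $\mathcal D(K_{n_1,\dots,n_d})$: (monotonicity) $H|_{A'_1\times\dots\times A'_d}$ has distribution $\mathcal D(K_{|A'_1|,\dots,|A'_d|})$; (block independence) if $A'_i\cap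 A''_i=\emptyset$ for all $i$, then $H|_{A'_1\times\dots\times A'_d}$ and $H|_{A''_1\times\dots\times A''_d}$ are independent. A *weak* model is a family $\mathcal D(K^{(d)}_n)$, $n\in\mathbb N$, for which these two properties are required only for $A'_1=\dots=A'_d=A'$ and $A''_1=\dots=A''_d=A''$. A distribution has *concentration constant* $h$ if for every median $\mathsf{Med}$ of $L(H)$ and all $s\ge0$, $$\Pr[L(H)\le(1-s)\mathsf{Med}]\le 2e^{-hs^2\mathsf{Med}},\qquad \Pr[L(H)\ge(1+s)\mathsf{Med}]\le 2e^{-h\frac{s^2}{1+s}\mathsf{Med}};$$ a model has concentration constant $h$ if each of its distributions has. Write $N=(n_1\cdots n_d)^{1/d}$ and $S=n_1+\dots+n_d$. Consider models $\mathcal D=\mathcal D_t$ depending on an internal parameter $t$ that ranges over a set $T\subseteq\mathbb R$. The family *admits a $(c,\lambda,\theta)$-approximate median* if for every $\delta>0$ there are $a,b,t'>0$ such that for all $t\in T$ with $t\ge t'$ and all class sizes (all equal class sizes, in the weak case) with $N\ge at^\lambda$ and $Sb\le t^\theta$, every median of $L(\mathcal D_t(K_{n_1,\dots,n_d}))$ lies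 in $[(1-\delta)cN/t^\lambda,(1+\delta)cN/t^\lambda]$. **Theorem.** There is an absolute constant $K>0$ such that the following holds. Let $d\ge2$, $h,c>0$, $\lambda,\theta\in\mathbb R$, $0\le\eta\le\lambda/(d-1)$, $\eta<\theta-\lambda$, and let $g:\mathbb R\to\mathbb R$ satisfy $g(t)=O(t^\eta)$ as $t\to\infty$. 1. Let $\mathcal D_t$ $(t\in T)$ be random $d$-partite hypergraph models with concentration constant $h$ (the same for all $t$) that admit a $(c,\lambda,\theta)$-approximate median. Then for every $\epsilon>0$ there are $t_0,A>0$ such that for all $t\in T$ with $t\ge t_0$ and all $n_1,\dots,n_d$ with $N\ge At^\lambda$ and $S\le g(t)N$, writing $L=L(\mathcal D_t(K_{n_1,\dots,n_d}))$: $$(1-\epsilon)\frac{cN}{t^\lambda}\le \mathbb E[L]\le(1+\epsilon)\frac{cN}{t^\lambda};\tag{a}$$ every median $\mathsf{Med}$ of $L$ satisfies $$(1-\epsilon)\frac{cN}{t^\lambda}\le\mathsf{Med}\le(1+\epsilon)\frac{cN}{t^\lambda};\tag{b}$$ $$\Pr\Big[L\le(1-\epsilon)\frac{cN}{t^\lambda}\Big]\le\exp\Big(-Kh\epsilon^2\frac{cN}{t^\lambda}\Big);\tag{c}$$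 $$\Pr\Big[L\ge(1+\epsilon)\frac{cN}{t^\lambda}\Big]\le\exp\Big(-Kh\frac{\epsilon^2}{1+\epsilon}\frac{cN}{t^\lambda}\Big).\tag{d}$$ 2. If $\mathcal D_t$ $(t\in T)$ are only weak random $d$-partite hypergraph models with concentration constant $h$ that admit a $(c,\lambda,\theta)$-approximate median, then for every $\epsilon>0$ there are $t_0,A>0$ such that for all $t\in T$ with $t\ge t_0$ and all $n_1=\dots=n_d=n$ with $N\ge At^\lambda$ and $S\le g(t)N$ (here $N=n$, $S=dn$), the lower bounds in (a) and (b) and inequality (c) hold for $L=L(\mathcal D_t(K^{(d)}_n))$. -/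

import Mathlib

open MeasureTheory ProbabilityTheory

/-- The (potential) edges of a `d`-partite hypergraph whose `i`-th colour class is the totally
ordered set `Fin (n i)`.  The natural partial order on edges is the product order. -/
abbrev PartiteEdge {d : ℕ} (n : Fin d → ℕ) : Type := (i : Fin d) → Fin (n i)

/-- A hyper-subgraph of the complete `d`-partite hypergraph `K_{n_1,…,n_d}`, given by its edge set.
The type is finite, and it carries the σ-algebra of all its subsets. -/
abbrev PartiteHypergraph {d : ℕ} (n : Fin d → ℕ) : Type := Set (PartiteEdge n)

/-- A set of edges is a non-crossing hyper-matching if its edges are pairwise node-disjoint and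
pairwise comparable. -/
def IsNonCrossingMatching {d : ℕ} {n : Fin d → ℕ} (M : Set (PartiteEdge n)) : Prop :=
  M.Pairwise fun e f => (∀ i, e i ≠ f i) ∧ (e ≤ f ∨ f ≤ e)

/-- `L(H)`: the size of a largest non-crossing hyper-matching contained in `H`. -/
noncomputable def largestMatching {d : ℕ} {n : Fin d → ℕ} (H : PartiteHypergraph n) : ℕ :=
  sSup {k : ℕ | ∃ M : Finset (PartiteEdge n),
    (M : Set (PartiteEdge n)) ⊆ H ∧ IsNonCrossingMatching (M : Set (PartiteEdge n)) ∧ M.card = k}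

/-- The maximum in the definition of `L(H)` is attained. -/
theorem isGreatest_largestMatching {d : ℕ} {n : Fin d → ℕ} (H : PartiteHypergraph n) :
    IsGreatest {k : ℕ | ∃ M : Finset (PartiteEdge n),
      (M : Set (PartiteEdge n)) ⊆ H ∧ IsNonCrossingMatching (M : Set (PartiteEdge n)) ∧
        M.card = k} (largestMatching H) := by
  have hb : BddAbove {k : ℕ | ∃ M : Finset (PartiteEdge n),
      (M : Set (PartiteEdge n)) ⊆ H ∧ IsNonCrossingMatching (M : Set (PartiteEdge n)) ∧
        M.card = k} := by
    refine ⟨Fintype.card (PartiteEdge n), ?_⟩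
    rintro k ⟨M, -, -, rfl⟩
    exact Finset.card_le_univ M
  refine ⟨Nat.sSup_mem ⟨0, ∅, ?_, ?_, rfl⟩ hb, fun k hk => le_csSup hb hk⟩
  · simp
  · simp [IsNonCrossingMatching]

/-- `L(H)` as a real number. -/
noncomputable def matchL {d : ℕ} {n : Fin d → ℕ} (H : PartiteHypergraph n) : ℝ :=
  (largestMatching H : ℝ)

/-- The hyper-subgraph of `H` induced by `A'_i ⊆ A_i`, where each `A'_i` is identified with
`Fin |A'_i|` through the unique order isomorphism. -/
def inducedSub {d : ℕ} {n : Fin d → ℕ} (A : (i : Fin d) → Finset (Fin (n i)))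
    (H : PartiteHypergraph n) : PartiteHypergraph (fun i => (A i).card) :=
  {e | (fun i => (A i).orderEmbOfFin rfl (e i)) ∈ H}

/-- A random `d`-partite hypergraph model: a probability distribution on the hyper-subgraphs of
each `K_{n_1,…,n_d}`, with monotonicity and block independence. -/
structure IsRandomModel {d : ℕ} (D : (n : Fin d → ℕ) → Measure (PartiteHypergraph n)) : Prop where
  prob : ∀ n, IsProbabilityMeasure (D n)
  monotone : ∀ (n : Fin d → ℕ) (A : (i : Fin d) → Finset (Fin (n i))),
    (D n).map (inducedSub A) = D (fun i => (A i).card)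
  block_indep : ∀ (n : Fin d → ℕ) (A B : (i : Fin d) → Finset (Fin (n i))),
    (∀ i, Disjoint (A i) (B i)) → IndepFun (inducedSub A) (inducedSub B) (D n)

/-- A weak random `d`-partite hypergraph model: a probability distribution on the hyper-subgraphs
of each `K_n^{(d)}` (all colour classes of size `n`), where monotonicity and block independence are
only required for the same subsets of `[n]` in all colour classes. -/
structure IsWeakRandomModel {d : ℕ}
    (D : (n : ℕ) → Measure (PartiteHypergraph (fun _ : Fin d => n))) : Prop where
  prob : ∀ n, IsProbabilityMeasure (D n)
  monotone : ∀ (n : ℕ) (A : Finset (Fin n)),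
    (D n).map (inducedSub (n := fun _ : Fin d => n) (fun _ => A)) = D A.card
  block_indep : ∀ (n : ℕ) (A B : Finset (Fin n)), Disjoint A B →
    IndepFun (inducedSub (n := fun _ : Fin d => n) (fun _ => A))
      (inducedSub (n := fun _ : Fin d => n) (fun _ => B)) (D n)

/-- `m` is a median of the real random variable `X`. -/
def IsMedianOf {Ω : Type} [MeasurableSpace Ω] (μ : Measure Ω) (X : Ω → ℝ) (m : ℝ) : Prop :=
  1 / 2 ≤ μ.real {ω | X ω ≤ m} ∧ 1 / 2 ≤ μ.real {ω | m ≤ X ω}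

/-- The distribution `μ` on `d`-partite hypergraphs has concentration constant `h`: the random
variable `L` is concentrated, with constant `h`, around any one of its medians. -/
def HasConcentrationConstant {d : ℕ} {n : Fin d → ℕ} (μ : Measure (PartiteHypergraph n))
    (h : ℝ) : Prop :=
  ∀ med : ℝ, IsMedianOf μ matchL med → ∀ s : ℝ, 0 ≤ s →
    μ.real {H | matchL H ≤ (1 - s) * med} ≤ 2 * Real.exp (-(h * s ^ 2 * med)) ∧
    μ.real {H | (1 + s) * med ≤ matchL H} ≤ 2 * Real.exp (-(h * (s ^ 2 / (1 + s)) * med))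

/-- The geometric mean of `n_1,…,n_d`. -/
noncomputable def geomMean {d : ℕ} (n : Fin d → ℕ) : ℝ :=
  (∏ i, (n i : ℝ)) ^ (1 / (d : ℝ))

/-- The sum of `n_1,…,n_d`. -/
noncomputable def sizeSum {d : ℕ} (n : Fin d → ℕ) : ℝ :=
  ∑ i, (n i : ℝ)

/-- A family of distributions, indexed by an internal parameter `t ∈ T` and by `k : ι`, where the
distribution with index `k` is on hyper-subgraphs of the complete hypergraph with class sizes
`size k`, admits a `(c, lam, θ)`-approximate median. For random models, `k` is the vector of class
sizes itself; for weak random models, `k` is the common class size. -/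
def AdmitsApproxMedian {d : ℕ} {ι : Type} (size : ι → Fin d → ℕ) (T : Set ℝ)
    (D : ℝ → (k : ι) → Measure (PartiteHypergraph (size k))) (c lam θ : ℝ) : Prop :=
  ∀ δ : ℝ, 0 < δ → ∃ a b t' : ℝ, 0 < a ∧ 0 < b ∧ 0 < t' ∧
    ∀ t ∈ T, t' ≤ t → ∀ k : ι,
      a * t ^ lam ≤ geomMean (size k) → sizeSum (size k) * b ≤ t ^ θ →
      ∀ med : ℝ, IsMedianOf (D t k) matchL med →
        (1 - δ) * (c * geomMean (size k) / t ^ lam) ≤ med ∧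
        med ≤ (1 + δ) * (c * geomMean (size k) / t ^ lam)

/-! The hypothesis on medians covers only class sizes with `S * b ≤ t ^ θ`. Larger hypergraphs are
cut into `q` boxes inside that range, and their medians are recovered by comparing `L` with what
happens in the boxes. The scale is `t ^ (lam + γ)` with `γ = (θ - lam - η) / 2`. If `N` is below it,
then `S = O(t ^ η * N)` puts the sizes in range directly. Otherwise `q` is chosen with `N / q`
between this scale and its double. The condition `η ≤ lam / (d - 1)` keeps every class at least of
order `t ^ γ` per box, so rounding is negligible (`rpow_div_le_class_size`).

Lower bound (`median_lower_bound`): `L` is at least the sum of its values on `q` successive equal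
blocks. Concentration makes each block unlikely to fall short, and Markov's inequality for the
number of short blocks suffices. No independence enters, and the blocks use the same intervals in
equal classes, so the argument also serves weak models.

Upper bound (`median_upper_bound`): a matching with `q * l` edges, cut at every `l`-th edge, yields
`q` disjoint boxes each carrying a matching of size `l` (`exists_chunkBox`). There are at most `(e *
N / q) ^ (d * q)` choices of cuts. For fixed cuts, a positive fraction of the boxes is not much
larger than average; for `l` slightly above the average share, each of these succeeds with
probability exponentially small in `t ^ γ`, and block independence multiplies these probabilities.
Since `N / q` is only polynomial in `t ^ γ`, the union bound wins
(`IsRandomModel.real_mul_le_largestMatching_le`).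

Once all medians are located, the concentration inequalities give the tails and the mean. -/

/-! ### Matchings as strictly increasing chains -/

/-- `P` contains `m` edges that increase strictly in every coordinate. -/
def HasChain {d : ℕ} {n : Fin d → ℕ} (P : Set (PartiteEdge n)) (m : ℕ) : Prop :=
  ∃ E : Fin m → PartiteEdge n, (∀ k, E k ∈ P) ∧ ∀ k k', k < k' → ∀ i, E k i < E k' i

theorem HasChain.mono {d : ℕ} {n : Fin d → ℕ} {P Q : Set (PartiteEdge n)} {m : ℕ}
    (h : HasChain P m) (hPQ : P ⊆ Q) : HasChain Q m := by
  obtain ⟨E, hE, hlt⟩ := h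
  exact ⟨E, fun k => hPQ (hE k), hlt⟩

theorem HasChain.of_le {d : ℕ} {n : Fin d → ℕ} {P : Set (PartiteEdge n)} {m m' : ℕ}
    (h : HasChain P m) (hm : m' ≤ m) : HasChain P m' := by
  obtain ⟨E, hE, hlt⟩ := h
  exact ⟨fun k => E (Fin.castLE hm k), fun k => hE _, fun k k' hk => hlt _ _ (by simpa using hk)⟩

theorem hasChain_zero {d : ℕ} {n : Fin d → ℕ} (P : Set (PartiteEdge n)) : HasChain P 0 :=
  ⟨fun k => k.elim0, fun k => k.elim0, fun k => k.elim0⟩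

theorem HasChain.add {d : ℕ} {n : Fin d → ℕ} {P Q : Set (PartiteEdge n)} {a b : ℕ}
    (hP : HasChain P a) (hQ : HasChain Q b) (hPQ : ∀ e ∈ P, ∀ f ∈ Q, ∀ i, e i < f i) :
    HasChain (P ∪ Q) (a + b) := by
  obtain ⟨E, hE, hlt⟩ := hP
  obtain ⟨F, hF, hlt'⟩ := hQ
  refine ⟨Fin.append E F, fun k => ?_, fun k k' hk i => ?_⟩
  · refine Fin.addCases (fun k => ?_) (fun k => ?_) k
    · simpa using Or.inl (hE k)
    · simpa using Or.inr (hF k)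
  · revert hk
    refine Fin.addCases (fun k => ?_) (fun k => ?_) k <;>
    refine Fin.addCases (fun k' => ?_) (fun k' => ?_) k' <;> intro hk
    · simpa using hlt k k' (Fin.lt_def.2 (Fin.lt_def.1 hk)) i
    · simpa using hPQ _ (hE k) _ (hF k') i
    · rw [Fin.lt_def] at hk
      simp only [Fin.val_natAdd, Fin.val_castAdd] at hk
      omega
    · simpa using hlt' k k' (by simpa using hk) i

/-- Disjointness makes one coordinate injective on the matching, so sorting by it enumerates the
edges. Comparability then forces the same strict order in every other coordinate. -/
theorem hasChain_card {d : ℕ} (hd : 0 < d) {n : Fin d → ℕ} (M : Finset (PartiteEdge n))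
    (hM : IsNonCrossingMatching (M : Set (PartiteEdge n))) :
    HasChain (M : Set (PartiteEdge n)) M.card := by
  classical
  let z : Fin d := ⟨0, hd⟩
  have hinj : Set.InjOn (fun e : PartiteEdge n => e z) (M : Set (PartiteEdge n)) := by
    intro e he f hf hef
    by_contra hne
    exact (hM he hf hne).1 z hef
  obtain ⟨S, hS⟩ : ∃ S, S = M.image fun e : PartiteEdge n => e z := ⟨_, rfl⟩
  have hcard : S.card = M.card := hS ▸ Finset.card_image_of_injOn hinj
  have hex : ∀ k : Fin M.card, ∃ e ∈ M, e z = S.orderEmbOfFin hcard k := by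
    intro k
    have hmem : ∀ x ∈ S, ∃ e ∈ M, e z = x := fun x hx => Finset.mem_image.1 (hS ▸ hx)
    exact hmem _ (S.orderEmbOfFin_mem hcard k)
  choose E hE hEz using hex
  refine ⟨E, hE, fun k k' hk i => ?_⟩
  have hz : E k z < E k' z := by
    rw [hEz, hEz]
    exact (S.orderEmbOfFin hcard).strictMono hk
  have hne : E k ≠ E k' := fun h => by rw [h] at hz; exact lt_irrefl _ hz
  obtain ⟨h1, h2⟩ := hM (hE k) (hE k') hne
  rcases h2 with h2 | h2
  · exact lt_of_le_of_ne (h2 i) (h1 i)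
  · exact absurd (h2 z) (not_le.2 hz)

theorem HasChain.exists_matching {d : ℕ} (hd : 0 < d) {n : Fin d → ℕ} {P : Set (PartiteEdge n)}
    {m : ℕ} (h : HasChain P m) : ∃ M : Finset (PartiteEdge n),
      (M : Set (PartiteEdge n)) ⊆ P ∧ IsNonCrossingMatching (M : Set (PartiteEdge n)) ∧
        M.card = m := by
  classical
  obtain ⟨E, hE, hlt⟩ := h
  have hinj : Function.Injective E := by
    intro k k' hkk
    by_contra hne
    rcases lt_or_gt_of_ne hne with h | h
    · exact absurd (congrFun hkk ⟨0, hd⟩) (hlt _ _ h _).ne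
    · exact absurd (congrFun hkk ⟨0, hd⟩) (hlt _ _ h _).ne'
  refine ⟨Finset.univ.image E, ?_, ?_, ?_⟩
  · intro e he
    obtain ⟨k, -, rfl⟩ := Finset.mem_image.1 (Finset.mem_coe.1 he)
    exact hE k
  · intro e he f hf hne
    obtain ⟨k, -, rfl⟩ := Finset.mem_image.1 (Finset.mem_coe.1 he)
    obtain ⟨k', -, rfl⟩ := Finset.mem_image.1 (Finset.mem_coe.1 hf)
    have hkk : k ≠ k' := fun h => hne (by rw [h])
    rcases lt_or_gt_of_ne hkk with h | h
    · exact ⟨fun i => (hlt _ _ h i).ne, Or.inl fun i => (hlt _ _ h i).le⟩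
    · exact ⟨fun i => (hlt _ _ h i).ne', Or.inr fun i => (hlt _ _ h i).le⟩
  · rw [Finset.card_image_of_injective _ hinj, Finset.card_univ, Fintype.card_fin]

theorem le_largestMatching_iff {d : ℕ} (hd : 0 < d) {n : Fin d → ℕ} (H : PartiteHypergraph n)
    (m : ℕ) : m ≤ largestMatching H ↔ HasChain H m := by
  have hg := isGreatest_largestMatching H
  constructor
  · intro hm
    obtain ⟨M, hMH, hM, hc⟩ := hg.1
    have := (hasChain_card hd M hM).mono hMH
    rw [hc] at this
    exact this.of_le hm
  · intro h
    exact hg.2 (h.exists_matching hd)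

/-! ### Induced hypergraphs and superadditivity -/

/-- The edges of `H` all of whose nodes lie in `A`. -/
def edgesWithin {d : ℕ} {n : Fin d → ℕ} (A : (i : Fin d) → Finset (Fin (n i)))
    (H : PartiteHypergraph n) : Set (PartiteEdge n) :=
  {e | e ∈ H ∧ ∀ i, e i ∈ A i}

theorem le_largestMatching_inducedSub_iff {d : ℕ} (hd : 0 < d) {n : Fin d → ℕ}
    (A : (i : Fin d) → Finset (Fin (n i))) (H : PartiteHypergraph n) (m : ℕ) :
    m ≤ largestMatching (inducedSub A H) ↔ HasChain (edgesWithin A H) m := by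
  rw [le_largestMatching_iff hd]
  constructor
  · rintro ⟨E, hE, hlt⟩
    refine ⟨fun k i => (A i).orderEmbOfFin rfl (E k i), fun k => ⟨hE k, fun i => ?_⟩,
      fun k k' hk i => ?_⟩
    · exact (A i).orderEmbOfFin_mem rfl _
    · exact ((A i).orderEmbOfFin rfl).strictMono (hlt k k' hk i)
  · rintro ⟨E, hE, hlt⟩
    have hex : ∀ k i, ∃ x : Fin (A i).card, (A i).orderEmbOfFin rfl x = E k i := by
      intro k i
      have : E k i ∈ Set.range ((A i).orderEmbOfFin rfl) := by
        rw [Finset.range_orderEmbOfFin]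
        exact (hE k).2 i
      exact this
    choose F hF using hex
    refine ⟨F, fun k => ?_, fun k k' hk i => ?_⟩
    · change (fun i => (A i).orderEmbOfFin rfl (F k i)) ∈ H
      rw [show (fun i => (A i).orderEmbOfFin rfl (F k i)) = E k from funext (hF k)]
      exact (hE k).1
    · rw [← ((A i).orderEmbOfFin rfl).lt_iff_lt, hF, hF]
      exact hlt k k' hk i

theorem largestMatching_inducedSub_le {d : ℕ} (hd : 0 < d) {n : Fin d → ℕ}
    (A : (i : Fin d) → Finset (Fin (n i))) (H : PartiteHypergraph n) :
    largestMatching (inducedSub A H) ≤ largestMatching H := by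
  rw [le_largestMatching_iff hd]
  exact ((le_largestMatching_inducedSub_iff hd A H _).1 le_rfl).mono fun e he => he.1

/-- The induced hypergraph on `A` determines the edges within `A`. -/
theorem edgesWithin_eq_of_inducedSub_eq {d : ℕ} {n : Fin d → ℕ}
    {A : (i : Fin d) → Finset (Fin (n i))} {H H' : PartiteHypergraph n}
    (h : inducedSub A H = inducedSub A H') : edgesWithin A H = edgesWithin A H' := by
  ext e
  refine and_congr_left fun he => ?_
  have hex : ∀ i, ∃ x : Fin (A i).card, (A i).orderEmbOfFin rfl x = e i := by
    intro i
    have : e i ∈ Set.range ((A i).orderEmbOfFin rfl) := by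
      rw [Finset.range_orderEmbOfFin]
      exact he i
    exact this
  choose x hx using hex
  have := Set.ext_iff.1 h x
  change (fun i => (A i).orderEmbOfFin rfl (x i)) ∈ H ↔
    (fun i => (A i).orderEmbOfFin rfl (x i)) ∈ H' at this
  rwa [show (fun i => (A i).orderEmbOfFin rfl (x i)) = e from funext hx] at this

/-- Events about a sub-box are thereby events about the hypergraph induced on any larger box, which
is the form block independence needs. -/
theorem largestMatching_inducedSub_congr {d : ℕ} (hd : 0 < d) {n : Fin d → ℕ}
    {A B : (i : Fin d) → Finset (Fin (n i))} (hBA : ∀ i, B i ⊆ A i) {H H' : PartiteHypergraph n}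
    (h : inducedSub A H = inducedSub A H') :
    largestMatching (inducedSub B H) = largestMatching (inducedSub B H') := by
  have hB : edgesWithin B H = edgesWithin B H' := by
    have hA := edgesWithin_eq_of_inducedSub_eq h
    ext e
    constructor
    · intro he
      have : e ∈ edgesWithin A H := ⟨he.1, fun i => hBA i (he.2 i)⟩
      rw [hA] at this
      exact ⟨this.1, he.2⟩
    · intro he
      have : e ∈ edgesWithin A H' := ⟨he.1, fun i => hBA i (he.2 i)⟩
      rw [← hA] at this
      exact ⟨this.1, he.2⟩
  refine eq_of_forall_le_iff fun m => ?_
  rw [le_largestMatching_inducedSub_iff hd, le_largestMatching_inducedSub_iff hd, hB]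

/-- `L` is superadditive over successive blocks. -/
theorem sum_largestMatching_inducedSub_le {d : ℕ} (hd : 0 < d) {n : Fin d → ℕ} (q : ℕ)
    (A : ℕ → (i : Fin d) → Finset (Fin (n i)))
    (hA : ∀ j j', j < j' → ∀ i, ∀ x ∈ A j i, ∀ y ∈ A j' i, x < y) (H : PartiteHypergraph n) :
    ∑ j ∈ Finset.range q, largestMatching (inducedSub (A j) H) ≤ largestMatching H := by
  -- The chain is confined to the first `q` blocks, so that in the induction the next block lies
  -- entirely above it.
  have key : HasChain {e | e ∈ H ∧ ∃ j < q, ∀ i, e i ∈ A j i}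
      (∑ j ∈ Finset.range q, largestMatching (inducedSub (A j) H)) := by
    induction q with
    | zero => exact hasChain_zero _
    | succ q ih =>
      rw [Finset.sum_range_succ]
      refine (ih.add ((le_largestMatching_inducedSub_iff hd (A q) H _).1 le_rfl) ?_).mono ?_
      · rintro e ⟨-, j, hj, he⟩ f ⟨-, hf⟩ i
        exact hA j q hj i _ (he i) _ (hf i)
      · rintro e (⟨he, j, hj, hej⟩ | ⟨he, hej⟩)
        · exact ⟨he, j, by omega, hej⟩
        · exact ⟨he, q, by omega, hej⟩
  rw [le_largestMatching_iff hd]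
  exact key.mono fun e he => he.1

/-! ### Tails and mean from bounds on the medians -/

/-- With `s = (y - m) / m` the exponent becomes `h * (y - m) ^ 2 / y`, which decreases in `m` up to
`y`; hence an upper bound `v` can replace the median. -/
theorem HasConcentrationConstant.real_le_of_median_le {d : ℕ} {n : Fin d → ℕ}
    {μ : Measure (PartiteHypergraph n)} {h v m y : ℝ}
    (hμ : HasConcentrationConstant μ h) (hh : 0 ≤ h) (hm : IsMedianOf μ matchL m) (hm0 : 0 < m)
    (hmv : m ≤ v) (hvy : v ≤ y) :
    μ.real {H | y ≤ matchL H} ≤ 2 * Real.exp (-(h * ((y - v) ^ 2 / y))) := by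
  have hy : 0 < y := by linarith
  have hc := (hμ m hm ((y - m) / m) (div_nonneg (by linarith) hm0.le)).2
  have h1 : (1 + (y - m) / m) = y / m := by field_simp; ring
  have h2 : h * (((y - m) / m) ^ 2 / (1 + (y - m) / m)) * m = h * ((y - m) ^ 2 / y) := by
    rw [h1]; field_simp
  rw [h2, h1, div_mul_cancel₀ _ hm0.ne'] at hc
  refine hc.trans ?_
  have : (y - v) ^ 2 ≤ (y - m) ^ 2 := by
    apply pow_le_pow_left₀ <;> linarith
  gcongr

section Distribution

variable {d : ℕ} {n : Fin d → ℕ} {μ : Measure (PartiteHypergraph n)} [IsProbabilityMeasure μ]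

theorem matchL_nonneg {d : ℕ} {n : Fin d → ℕ} (H : PartiteHypergraph n) : 0 ≤ matchL H :=
  Nat.cast_nonneg _

/-- The least integer `k` with `Pr[L ≤ k] ≥ 1/2` works: `L` is integer-valued, so `L ≥ k` is the
complement of `L ≤ k - 1`. -/
theorem exists_isMedianOf_matchL (μ : Measure (PartiteHypergraph n)) [IsProbabilityMeasure μ] :
    ∃ med, IsMedianOf μ matchL med := by
  classical
  obtain ⟨B, hB⟩ : ∃ B, ∀ H : PartiteHypergraph n, largestMatching H ≤ B :=
    ⟨Fintype.card (PartiteEdge n), fun H => by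
      obtain ⟨M, -, -, hM⟩ := (isGreatest_largestMatching H).1
      exact hM ▸ Finset.card_le_univ M⟩
  have hex : ∃ k : ℕ, 1 / 2 ≤ μ.real {H | matchL H ≤ k} := by
    refine ⟨B, ?_⟩
    rw [show {H : PartiteHypergraph n | matchL H ≤ B} = Set.univ from
      Set.eq_univ_of_forall fun H => by simpa [matchL] using hB H]
    norm_num
  refine ⟨(Nat.find hex : ℕ), Nat.find_spec hex, ?_⟩
  rcases Nat.eq_zero_or_pos (Nat.find hex) with h0 | hpos
  · rw [h0, show {H : PartiteHypergraph n | ((0 : ℕ) : ℝ) ≤ matchL H} = Set.univ from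
      Set.eq_univ_of_forall fun H => by simpa using matchL_nonneg H]
    norm_num
  · have hlt := Nat.find_min hex (m := Nat.find hex - 1) (by omega)
    have hc : {H : PartiteHypergraph n | ((Nat.find hex : ℕ) : ℝ) ≤ matchL H} =
        {H | matchL H ≤ ((Nat.find hex - 1 : ℕ) : ℝ)}ᶜ := by
      ext H
      change ((Nat.find hex : ℕ) : ℝ) ≤ (largestMatching H : ℝ) ↔
        ¬ ((largestMatching H : ℝ) ≤ ((Nat.find hex - 1 : ℕ) : ℝ))
      rw [Nat.cast_le, Nat.cast_le]
      omega
    rw [hc, probReal_compl_eq_one_sub (Set.toFinite _).measurableSet]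
    linarith

theorem IsMedianOf.gt_of_real_lt {m v : ℝ} (hm : IsMedianOf μ matchL m)
    (h : μ.real {H | matchL H ≤ v} < 1 / 2) : v < m := by
  by_contra! hle
  have := measureReal_mono (μ := μ) (s₁ := {H | matchL H ≤ m}) (s₂ := {H | matchL H ≤ v})
    fun H (hH : matchL H ≤ m) => hH.trans hle
  linarith [hm.1]

theorem IsMedianOf.lt_of_real_lt {m v : ℝ} (hm : IsMedianOf μ matchL m)
    (h : μ.real {H | v ≤ matchL H} < 1 / 2) : m < v := by
  by_contra! hle
  have := measureReal_mono (μ := μ) (s₁ := {H | m ≤ matchL H}) (s₂ := {H | v ≤ matchL H})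
    fun H (hH : m ≤ matchL H) => hle.trans hH
  linarith [hm.2]

theorem HasConcentrationConstant.real_le_of_le_median {h v m s : ℝ}
    (hμ : HasConcentrationConstant μ h) (hh : 0 ≤ h) (hm : IsMedianOf μ matchL m) (hvm : v ≤ m)
    (hs : 0 ≤ s) (hs1 : s ≤ 1) :
    μ.real {H | matchL H ≤ (1 - s) * v} ≤ 2 * Real.exp (-(h * s ^ 2 * v)) := by
  refine (measureReal_mono fun H (hH : matchL H ≤ (1 - s) * v) => ?_).trans
    ((hμ m hm s hs).1.trans ?_)
  · exact hH.trans (mul_le_mul_of_nonneg_left hvm (by linarith))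
  · have : h * s ^ 2 * v ≤ h * s ^ 2 * m := mul_le_mul_of_nonneg_left hvm (by positivity)
    gcongr

theorem HasConcentrationConstant.real_le_of_forall_median_le {h v y : ℝ}
    (hμ : HasConcentrationConstant μ h) (hh : 0 ≤ h)
    (hm : ∀ m, IsMedianOf μ matchL m → 0 < m ∧ m ≤ v) (hvy : v ≤ y) :
    μ.real {H | y ≤ matchL H} ≤ 2 * Real.exp (-(h * ((y - v) ^ 2 / y))) := by
  obtain ⟨m, hm'⟩ := exists_isMedianOf_matchL μ
  exact hμ.real_le_of_median_le hh hm' (hm m hm').1 (hm m hm').2 hvy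

/-- A deviation of `s = ε / 2` below `(1 - ε / 2) * X` already covers the event and gives an
exponent of at least `h * ε ^ 2 * X / 8`. Half of that absorbs the factor 2, whence `1 / 16`. For `ε
> 1` the event is empty. -/
theorem lower_tail_of_median {h X ε : ℝ} (hμ : HasConcentrationConstant μ h) (hh : 0 < h)
    (hX : 0 < X) (hε : 0 < ε)
    (hm : ∀ m, IsMedianOf μ matchL m → (1 - ε / 2) * X ≤ m)
    (hlarge : Real.log 2 ≤ h * ε ^ 2 * X / 16) :
    μ.real {H | matchL H ≤ (1 - ε) * X} ≤ Real.exp (-(1 / 16 * h * ε ^ 2 * X)) := by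
  rcases lt_or_ge 1 ε with h1 | h1
  · rw [show {H : PartiteHypergraph n | matchL H ≤ (1 - ε) * X} = ∅ from
      Set.eq_empty_of_forall_notMem fun H (hH : matchL H ≤ (1 - ε) * X) => by
        nlinarith [matchL_nonneg H]]
    simpa using (Real.exp_pos _).le
  · obtain ⟨m, hm'⟩ := exists_isMedianOf_matchL μ
    have hc := hμ.real_le_of_le_median hh.le hm' (hm m hm') (s := ε / 2) (by linarith)
      (by linarith)
    refine (measureReal_mono fun H (hH : matchL H ≤ (1 - ε) * X) => ?_).trans (hc.trans ?_)
    · have : (1 - ε) * X ≤ (1 - ε / 2) * ((1 - ε / 2) * X) := by nlinarith [sq_nonneg (ε * X)]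
      exact hH.trans this
    · have : h * (ε / 2) ^ 2 * ((1 - ε / 2) * X) ≥ h * ε ^ 2 * X / 8 := by
        have hp : 0 ≤ h * ε ^ 2 * X := by positivity
        nlinarith
      calc 2 * Real.exp (-(h * (ε / 2) ^ 2 * ((1 - ε / 2) * X)))
          = Real.exp (Real.log 2 + -(h * (ε / 2) ^ 2 * ((1 - ε / 2) * X))) := by
            rw [Real.exp_add, Real.exp_log two_pos]
        _ ≤ _ := Real.exp_le_exp.2 (by linarith)

theorem upper_tail_of_median {h X ε : ℝ} (hμ : HasConcentrationConstant μ h) (hh : 0 < h)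
    (hX : 0 < X) (hε : 0 < ε)
    (hm : ∀ m, IsMedianOf μ matchL m → 0 < m ∧ m ≤ (1 + ε / 2) * X)
    (hlarge : Real.log 2 ≤ h * (ε ^ 2 / (1 + ε)) * X / 16) :
    μ.real {H | (1 + ε) * X ≤ matchL H} ≤ Real.exp (-(1 / 16 * h * (ε ^ 2 / (1 + ε)) * X)) := by
  have hc := hμ.real_le_of_forall_median_le hh.le hm
    (y := (1 + ε) * X) (by nlinarith)
  refine hc.trans ?_
  have h1 : h * (((1 + ε) * X - (1 + ε / 2) * X) ^ 2 / ((1 + ε) * X)) =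
      h * (ε ^ 2 / (1 + ε)) * X / 4 := by
    field_simp
    ring
  have hp : 0 ≤ h * (ε ^ 2 / (1 + ε)) * X := by positivity
  rw [h1]
  calc 2 * Real.exp (-(h * (ε ^ 2 / (1 + ε)) * X / 4))
      = Real.exp (Real.log 2 + -(h * (ε ^ 2 / (1 + ε)) * X / 4)) := by
        rw [Real.exp_add, Real.exp_log two_pos]
    _ ≤ _ := Real.exp_le_exp.2 (by linarith)

theorem integrable_of_finite_hypergraph (f : PartiteHypergraph n → ℝ) : Integrable f μ :=
  Integrable.of_finite

/-- One factor `1 - δ` comes from the median, one from the deviation below it, and one from the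
probability that this deviation does not occur. -/
theorem le_integral_matchL_of_median {h X δ : ℝ} (hμ : HasConcentrationConstant μ h) (hh : 0 < h)
    (hX : 0 < X) (hδ : 0 < δ) (hδ1 : δ ≤ 1 / 2)
    (hm : ∀ m, IsMedianOf μ matchL m → (1 - δ) * X ≤ m)
    (hlarge : 2 * Real.exp (-(h * δ ^ 2 * X / 2)) ≤ δ) :
    (1 - δ) ^ 3 * X ≤ ∫ H, matchL H ∂μ := by
  obtain ⟨m, hm'⟩ := exists_isMedianOf_matchL μ
  have hc := hμ.real_le_of_le_median hh.le hm' (hm m hm') (s := δ) hδ.le (by linarith)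
  have hexp : 2 * Real.exp (-(h * δ ^ 2 * ((1 - δ) * X))) ≤ 2 * Real.exp (-(h * δ ^ 2 * X / 2)) := by
    have hp : 0 ≤ h * δ ^ 2 * X := by positivity
    have : h * δ ^ 2 * X / 2 ≤ h * δ ^ 2 * ((1 - δ) * X) := by nlinarith
    gcongr
  set v := (1 - δ) * ((1 - δ) * X) with hv
  have hv0 : 0 ≤ v := mul_nonneg (by linarith) (mul_nonneg (by linarith) hX.le)
  have hS : MeasurableSet {H : PartiteHypergraph n | matchL H ≤ v} := (Set.toFinite _).measurableSet
  have hcompl : 1 - δ ≤ μ.real {H | matchL H ≤ v}ᶜ := by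
    rw [probReal_compl_eq_one_sub hS]
    linarith
  calc (1 - δ) ^ 3 * X = (1 - δ) * v := by rw [hv]; ring
    _ ≤ μ.real {H | matchL H ≤ v}ᶜ * v := mul_le_mul_of_nonneg_right hcompl hv0
    _ = ∫ H, ({H | matchL H ≤ v}ᶜ).indicator (fun _ => v) H ∂μ := by
        rw [integral_indicator_const _ hS.compl, smul_eq_mul]
    _ ≤ ∫ H, matchL H ∂μ := by
        refine integral_mono (integrable_of_finite_hypergraph _) (integrable_of_finite_hypergraph _)
          fun H => ?_
        by_cases hH : matchL H ≤ v
        · rw [Set.indicator_of_notMem (by simpa using hH)]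
          exact matchL_nonneg H
        · rw [Set.indicator_of_mem (by simpa using hH)]
          exact (not_le.1 hH).le

theorem integral_matchL_le_add_sum (M : ℝ) : ∃ B : ℕ,
    ∫ H, matchL H ∂μ ≤ M + ∑ k ∈ Finset.range B, μ.real {H | M + k ≤ matchL H} := by
  obtain ⟨B, hB⟩ : ∃ B : ℕ, ∀ H : PartiteHypergraph n, matchL H - M ≤ B := by
    obtain ⟨B, hB⟩ := (Set.finite_range fun H : PartiteHypergraph n => matchL H - M).bddAbove
    obtain ⟨B', hB'⟩ := exists_nat_ge B
    exact ⟨B', fun H => (hB ⟨H, rfl⟩).trans hB'⟩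
  refine ⟨B, ?_⟩
  have hpt : ∀ H : PartiteHypergraph n, matchL H ≤
      M + ∑ k ∈ Finset.range B, ({H | M + k ≤ matchL H} : Set _).indicator (fun _ => (1 : ℝ)) H := by
    intro H
    -- Layer-cake formula in unit steps: each `k` below the ceiling contributes an indicator equal
    -- to 1.
    have h1 : ((⌈matchL H - M⌉₊ : ℕ) : ℝ) ≤ ∑ k ∈ Finset.range B,
        ({H | M + k ≤ matchL H} : Set _).indicator (fun _ => (1 : ℝ)) H := by
      calc ((⌈matchL H - M⌉₊ : ℕ) : ℝ) = ∑ k ∈ Finset.range ⌈matchL H - M⌉₊, (1 : ℝ) := by simp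
        _ = ∑ k ∈ Finset.range ⌈matchL H - M⌉₊,
            ({H | M + k ≤ matchL H} : Set _).indicator (fun _ => (1 : ℝ)) H := by
          refine Finset.sum_congr rfl fun k hk => ?_
          rw [Set.indicator_of_mem]
          have := Nat.lt_ceil.1 (Finset.mem_range.1 hk)
          change M + k ≤ matchL H
          linarith
        _ ≤ _ := Finset.sum_le_sum_of_subset_of_nonneg
          (Finset.range_subset_range.2 (Nat.ceil_le.2 (hB H)))
          fun k _ _ => Set.indicator_nonneg (fun _ _ => zero_le_one) _
    linarith [Nat.le_ceil (matchL H - M)]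
  calc ∫ H, matchL H ∂μ ≤ ∫ H, (M + ∑ k ∈ Finset.range B,
        ({H | M + k ≤ matchL H} : Set _).indicator (fun _ => (1 : ℝ)) H) ∂μ :=
        integral_mono (integrable_of_finite_hypergraph _) (integrable_of_finite_hypergraph _) hpt
    _ = _ := by
      rw [integral_add (integrable_of_finite_hypergraph _) (integrable_of_finite_hypergraph _),
        integral_finsetSum _ fun _ _ => integrable_of_finite_hypergraph _]
      congr 1
      · simp
      · refine Finset.sum_congr rfl fun k _ => ?_
        rw [integral_indicator_const _ (Set.toFinite _).measurableSet, smul_eq_mul, mul_one]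

/-- At height `y = (1 + δ) ^ 2 * X + k` the excess over `(1 + δ) * X` is at least `k` and at least
`δ / (1 + δ) * y`. The tails are therefore dominated by a geometric series whose sum does not depend
on `X`, and `δ * X` absorbs it. -/
theorem integral_matchL_le_of_median {h X δ : ℝ} (hμ : HasConcentrationConstant μ h) (hh : 0 < h)
    (hX : 0 < X) (hδ : 0 < δ)
    (hm : ∀ m, IsMedianOf μ matchL m → 0 < m ∧ m ≤ (1 + δ) * X)
    (hlarge : 2 * (1 - Real.exp (-(h * (δ / (1 + δ)))))⁻¹ ≤ δ * X) :
    ∫ H, matchL H ∂μ ≤ ((1 + δ) ^ 2 + δ) * X := by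
  obtain ⟨B, hB⟩ := integral_matchL_le_add_sum (μ := μ) ((1 + δ) ^ 2 * X)
  have hterm : ∀ k ∈ Finset.range B, μ.real {H | (1 + δ) ^ 2 * X + k ≤ matchL H} ≤
      2 * Real.exp (-(h * (δ / (1 + δ)))) ^ k := by
    intro k _
    have hk : (0 : ℝ) ≤ k := Nat.cast_nonneg k
    have hXδ : 0 < δ * X := by positivity
    refine (hμ.real_le_of_forall_median_le hh.le hm
      (y := (1 + δ) ^ 2 * X + k) (by nlinarith)).trans ?_
    rw [← Real.exp_nat_mul]
    have : k * (δ / (1 + δ)) ≤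
        ((1 + δ) ^ 2 * X + k - (1 + δ) * X) ^ 2 / ((1 + δ) ^ 2 * X + k) := by
      rw [← mul_div_assoc, div_le_div_iff₀ (by positivity) (by positivity)]
      have e1 : (1 + δ) ^ 2 * X + k - (1 + δ) * X = δ * (1 + δ) * X + k := by ring
      rw [e1]
      have : 0 ≤ δ ^ 2 * (1 + δ) ^ 3 * X ^ 2 := by positivity
      have : 0 ≤ k * (δ * (1 + δ) ^ 2 * X) := by positivity
      nlinarith
    have := mul_le_mul_of_nonneg_left this hh.le
    have e2 : (k : ℝ) * -(h * (δ / (1 + δ))) = -(h * (k * (δ / (1 + δ)))) := by ring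
    rw [e2]
    gcongr
  have hr1 : Real.exp (-(h * (δ / (1 + δ)))) < 1 := Real.exp_lt_one_iff.2 (by
    have : 0 < h * (δ / (1 + δ)) := by positivity
    linarith)
  have hgeo : ∑ k ∈ Finset.range B, Real.exp (-(h * (δ / (1 + δ)))) ^ k ≤
      (1 - Real.exp (-(h * (δ / (1 + δ)))))⁻¹ := by
    rw [← tsum_geometric_of_lt_one (Real.exp_pos _).le hr1]
    exact (summable_geometric_of_lt_one (Real.exp_pos _).le hr1).sum_le_tsum _
      fun _ _ => by positivity
  have hsum := Finset.sum_le_sum hterm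
  rw [← Finset.mul_sum] at hsum
  linarith

end Distribution

/-! ### Geometric means and class sizes -/

theorem geomMean_nonneg {d : ℕ} (n : Fin d → ℕ) : 0 ≤ geomMean n :=
  Real.rpow_nonneg (Finset.prod_nonneg fun _ _ => Nat.cast_nonneg _) _

theorem geomMean_pow {d : ℕ} (hd : 0 < d) (n : Fin d → ℕ) :
    geomMean n ^ d = ∏ i, (n i : ℝ) := by
  rw [geomMean, one_div]
  exact Real.rpow_inv_natCast_pow (Finset.prod_nonneg fun _ _ => Nat.cast_nonneg _) hd.ne'

theorem mul_geomMean_le {d : ℕ} (hd : 0 < d) {n m : Fin d → ℕ} {r : ℝ} (hr : 0 ≤ r)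
    (h : ∀ i, r * n i ≤ m i) : r * geomMean n ≤ geomMean m := by
  refine le_of_pow_le_pow_left₀ hd.ne' (geomMean_nonneg m) ?_
  rw [mul_pow, geomMean_pow hd, geomMean_pow hd]
  calc r ^ d * ∏ i, (n i : ℝ) = ∏ i, (r * n i) := by
        rw [Finset.prod_mul_distrib, Finset.prod_const, Finset.card_univ, Fintype.card_fin]
    _ ≤ _ := Finset.prod_le_prod (fun i _ => by positivity) fun i _ => h i

/-- AM-GM for the ratios `m i / n i`. Sums of ratios are additive over disjoint boxes, which
geometric means are not, so box sizes are controlled through them. -/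
theorem geomMean_le_of_sum_div_le {d : ℕ} (hd : 0 < d) {n m : Fin d → ℕ} (hn : ∀ i, 0 < n i)
    {r : ℝ} (h : ∑ i, (m i : ℝ) / n i ≤ d * r) : geomMean m ≤ r * geomMean n := by
  have hd' : (0 : ℝ) < d := Nat.cast_pos.2 hd
  have hz : ∀ i, (0 : ℝ) ≤ (m i : ℝ) / n i := fun i => by positivity
  have hr : 0 ≤ r := by
    have := (Finset.sum_nonneg fun i (_ : i ∈ Finset.univ) => hz i).trans h
    exact nonneg_of_mul_nonneg_right this hd'
  have hamgm := Real.geom_mean_le_arith_mean Finset.univ (fun _ : Fin d => (1 : ℝ))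
    (fun i => (m i : ℝ) / n i) (fun _ _ => zero_le_one) (by simpa using hd) fun i _ => hz i
  simp only [Real.rpow_one, one_mul, Finset.sum_const, Finset.card_univ, Fintype.card_fin,
    nsmul_eq_mul, mul_one] at hamgm
  have hprod : ∏ i, (m i : ℝ) / n i ≤ r ^ d := by
    have h1 : (∏ i, (m i : ℝ) / n i) ^ ((d : ℝ)⁻¹) ≤ r :=
      hamgm.trans ((div_le_iff₀ hd').2 (by linarith))
    have h2 := pow_le_pow_left₀ (Real.rpow_nonneg (Finset.prod_nonneg fun i _ => hz i) _) h1 d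
    rwa [Real.rpow_inv_natCast_pow (Finset.prod_nonneg fun i _ => hz i) hd.ne'] at h2
  refine le_of_pow_le_pow_left₀ hd.ne' (mul_nonneg hr (geomMean_nonneg n)) ?_
  rw [mul_pow, geomMean_pow hd, geomMean_pow hd]
  calc ∏ i, (m i : ℝ) = (∏ i, (m i : ℝ) / n i) * ∏ i, (n i : ℝ) := by
        rw [← Finset.prod_mul_distrib]
        refine Finset.prod_congr rfl fun i _ => ?_
        rw [div_mul_cancel₀]
        exact_mod_cast (hn i).ne'
    _ ≤ _ := mul_le_mul_of_nonneg_right hprod (Finset.prod_nonneg fun _ _ => Nat.cast_nonneg _)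

/-- If the sum of the class sizes is at most `Q` times their geometric mean, then no class is much
smaller than the geometric mean. -/
theorem geomMean_le_pow_mul {d : ℕ} (hd : 0 < d) {n : Fin d → ℕ} {Q : ℝ} (hN : 0 < geomMean n)
    (hS : sizeSum n ≤ Q * geomMean n) (i : Fin d) : geomMean n ≤ Q ^ (d - 1) * n i := by
  have hle : ∀ k, (n k : ℝ) ≤ Q * geomMean n := fun k =>
    (Finset.single_le_sum (f := fun k => (n k : ℝ)) (fun _ _ => Nat.cast_nonneg _)
      (Finset.mem_univ k)).trans hS
  have hprod : ∏ k ∈ Finset.univ.erase i, (n k : ℝ) ≤ (Q * geomMean n) ^ (d - 1) := by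
    have h := Finset.prod_le_prod (s := Finset.univ.erase i) (f := fun k => (n k : ℝ))
      (g := fun _ => Q * geomMean n) (fun _ _ => Nat.cast_nonneg _) fun k _ => hle k
    rwa [Finset.prod_const, Finset.card_erase_of_mem (Finset.mem_univ i), Finset.card_univ,
      Fintype.card_fin] at h
  have h1 : geomMean n * geomMean n ^ (d - 1) ≤ Q ^ (d - 1) * n i * geomMean n ^ (d - 1) := by
    rw [← pow_succ', Nat.sub_add_cancel hd, geomMean_pow hd,
      ← Finset.mul_prod_erase _ _ (Finset.mem_univ i)]
    calc (n i : ℝ) * ∏ k ∈ Finset.univ.erase i, (n k : ℝ)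
        ≤ n i * (Q * geomMean n) ^ (d - 1) := mul_le_mul_of_nonneg_left hprod (Nat.cast_nonneg _)
      _ = _ := by rw [mul_pow]; ring
  exact le_of_mul_le_mul_right h1 (by positivity)

/-- With `Q = C * t ^ η` in `geomMean_le_pow_mul`, the loss `Q ^ (d - 1)` is at most `C ^ (d - 1) *
t ^ lam`, exactly because `η * (d - 1) ≤ lam`; the factor `t ^ γ` survives. -/
theorem rpow_div_le_class_size {d : ℕ} (hd : 2 ≤ d) {n : Fin d → ℕ} {t lam η γ C : ℝ} {q : ℕ}
    (ht : 1 ≤ t) (hη : η ≤ lam / ((d : ℝ) - 1)) (hC : 0 < C) (hq : 0 < q)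
    (hS : sizeSum n ≤ C * t ^ η * geomMean n) (hN : t ^ (lam + γ) ≤ geomMean n / q) (i : Fin d) :
    t ^ γ / C ^ (d - 1) ≤ (n i : ℝ) / q := by
  have ht0 : 0 < t := by linarith
  have hq' : (0 : ℝ) < q := Nat.cast_pos.2 hq
  have hd1 : (0 : ℝ) < (d : ℝ) - 1 := by
    have : (2 : ℝ) ≤ d := by exact_mod_cast hd
    linarith
  have hN0 : 0 < geomMean n := by
    have := (Real.rpow_pos_of_pos ht0 (lam + γ)).trans_le hN
    by_contra! hle
    exact absurd this (not_lt.2 (div_nonpos_of_nonpos_of_nonneg hle hq'.le))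
  have h1 := geomMean_le_pow_mul (by omega) hN0 hS i
  have h2 : (t ^ η) ^ (d - 1) ≤ t ^ lam := by
    rw [← Real.rpow_mul_natCast ht0.le]
    refine Real.rpow_le_rpow_of_exponent_le ht ?_
    rw [Nat.cast_sub (by omega), Nat.cast_one]
    exact (le_div_iff₀ hd1).1 hη
  rw [mul_pow] at h1
  rw [Real.rpow_add ht0, le_div_iff₀ hq'] at hN
  rw [div_le_div_iff₀ (by positivity) hq']
  have h3 : t ^ lam * (t ^ γ * q) ≤ t ^ lam * (n i * C ^ (d - 1)) := by
    calc t ^ lam * (t ^ γ * q) = t ^ lam * t ^ γ * q := by ring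
      _ ≤ C ^ (d - 1) * (t ^ η) ^ (d - 1) * n i := hN.trans h1
      _ ≤ C ^ (d - 1) * t ^ lam * n i := by gcongr
      _ = _ := by ring
  exact le_of_mul_le_mul_left h3 (Real.rpow_pos_of_pos ht0 lam)

theorem exists_div_mem_Icc {x τ : ℝ} (hτ : 0 < τ) (hx : τ ≤ x) :
    ∃ q : ℕ, 0 < q ∧ τ ≤ x / q ∧ x / q ≤ 2 * τ := by
  have h1 : 1 ≤ x / τ := (one_le_div hτ).2 hx
  have hq : 0 < ⌊x / τ⌋₊ := Nat.floor_pos.2 h1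
  have hq' : (0 : ℝ) < ⌊x / τ⌋₊ := Nat.cast_pos.2 hq
  have hq1 : (1 : ℝ) ≤ ⌊x / τ⌋₊ := by exact_mod_cast hq
  refine ⟨_, hq, ?_, ?_⟩
  · rw [le_div_iff₀ hq', mul_comm, ← le_div_iff₀ hτ]
    exact Nat.floor_le (by linarith)
  · rw [div_le_iff₀ hq']
    have := (Nat.lt_floor_add_one (x / τ)).le
    rw [div_le_iff₀ hτ] at this
    nlinarith

/-! ### Lower bound on the medians -/

/-- The `j`-th of `q` successive blocks of `⌊n_i / q⌋` nodes in each colour class. -/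
def evenBlock {d : ℕ} (n : Fin d → ℕ) (q j : ℕ) (i : Fin d) : Finset (Fin (n i)) :=
  Finset.univ.filter fun x => j * (n i / q) ≤ (x : ℕ) ∧ (x : ℕ) < (j + 1) * (n i / q)

theorem card_evenBlock {d : ℕ} (n : Fin d → ℕ) {q j : ℕ} (hj : j < q) (i : Fin d) :
    (evenBlock n q j i).card = n i / q := by
  have hle : (j + 1) * (n i / q) ≤ n i :=
    (Nat.mul_le_mul_right _ hj).trans (Nat.mul_div_le _ _)
  have hmap : (evenBlock n q j i).map Fin.valEmbedding =
      Finset.Ico (j * (n i / q)) ((j + 1) * (n i / q)) := by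
    ext x
    simp only [evenBlock, Finset.mem_map, Finset.mem_filter, Finset.mem_univ, true_and,
      Fin.valEmbedding_apply, Finset.mem_Ico]
    constructor
    · rintro ⟨y, hy, rfl⟩
      exact hy
    · intro hx
      exact ⟨⟨x, by omega⟩, hx, rfl⟩
  rw [← Finset.card_map Fin.valEmbedding, hmap, Nat.card_Ico, Nat.add_mul, one_mul,
    Nat.add_sub_cancel_left]

theorem evenBlock_lt {d : ℕ} (n : Fin d → ℕ) (q : ℕ) {j j' : ℕ} (hj : j < j') (i : Fin d)
    (x : Fin (n i)) (hx : x ∈ evenBlock n q j i) (y : Fin (n i)) (hy : y ∈ evenBlock n q j' i) :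
    x < y := by
  simp only [evenBlock, Finset.mem_filter] at hx hy
  have := Nat.mul_le_mul_right (n i / q) hj
  rw [Nat.succ_eq_add_one] at this
  exact Fin.lt_def.2 (by omega)

/-- If `L ≤ (1 - δ) ^ 2 * q * v`, superadditivity makes at least `δ * q` blocks fall to `(1 - δ) *
v` or below. The expected number of such blocks is at most `q * δ / 3`, so by Markov this has
probability at most `1 / 3`, too little for a median. -/
theorem le_median_of_blocks {d : ℕ} (hd : 0 < d) {n m : Fin d → ℕ}
    {μ : Measure (PartiteHypergraph n)} [IsProbabilityMeasure μ]
    {ν : Measure (PartiteHypergraph m)} [IsProbabilityMeasure ν] {h δ v : ℝ} {q : ℕ}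
    (hν : HasConcentrationConstant ν h) (hh : 0 < h) (hq : 0 < q) (hδ : 0 < δ) (hδ1 : δ < 1)
    (hv : 0 < v)
    (hblock : ∀ j < q, ∀ x : ℝ, μ.real {H | matchL (inducedSub (evenBlock n q j) H) ≤ x} =
      ν.real {H | matchL H ≤ x})
    (hmed : ∀ med, IsMedianOf ν matchL med → v ≤ med)
    (hlarge : 2 * Real.exp (-(h * δ ^ 2 * v)) ≤ δ / 3) {med : ℝ}
    (hm : IsMedianOf μ matchL med) : (1 - δ) ^ 2 * (q * v) ≤ med := by
  classical
  have hq' : (0 : ℝ) < q := Nat.cast_pos.2 hq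
  obtain ⟨m₀, hm₀⟩ := exists_isMedianOf_matchL ν
  have hbad := (hν.real_le_of_le_median hh.le hm₀ (hmed _ hm₀) hδ.le hδ1.le).trans hlarge
  set bad : ℕ → Set (PartiteHypergraph n) :=
    fun j => {H | matchL (inducedSub (evenBlock n q j) H) ≤ (1 - δ) * v} with hbaddef
  set F : PartiteHypergraph n → ℝ := fun H =>
    ∑ j ∈ Finset.range q, (bad j).indicator (fun _ => (1 : ℝ)) H with hF
  have hF0 : ∀ H, 0 ≤ F H := fun H =>
    Finset.sum_nonneg fun j _ => Set.indicator_nonneg (fun _ _ => zero_le_one) _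
  have hEF : ∫ H, F H ∂μ ≤ q * (δ / 3) := by
    rw [hF, integral_finsetSum _ fun _ _ => integrable_of_finite_hypergraph _]
    calc ∑ j ∈ Finset.range q, ∫ H, (bad j).indicator (fun _ => (1 : ℝ)) H ∂μ
        ≤ ∑ j ∈ Finset.range q, δ / 3 := Finset.sum_le_sum fun j hj => by
          rw [integral_indicator_const _ (Set.toFinite _).measurableSet, smul_eq_mul, mul_one,
            hblock j (Finset.mem_range.1 hj)]
          exact hbad
      _ = _ := by simp
  have hmarkov := mul_meas_ge_le_integral_of_nonneg (μ := μ) (Filter.Eventually.of_forall hF0)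
    (integrable_of_finite_hypergraph F) (q * δ)
  have hprob : μ.real {H | q * δ ≤ F H} ≤ 1 / 3 := by
    have : q * δ * μ.real {H | q * δ ≤ F H} ≤ q * δ * (1 / 3) := by
      refine (hmarkov.trans hEF).trans_eq (by ring)
    exact le_of_mul_le_mul_left this (by positivity)
  refine (hm.gt_of_real_lt (lt_of_le_of_lt (measureReal_mono fun H hH => ?_)
    (hprob.trans_lt (by norm_num)))).le
  change matchL H ≤ (1 - δ) ^ 2 * (q * v) at hH
  change q * δ ≤ F H
  have hsum : ∑ j ∈ Finset.range q, (1 - δ) * v *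
      (1 - (bad j).indicator (fun _ => (1 : ℝ)) H) ≤ matchL H := by
    calc _ ≤ ∑ j ∈ Finset.range q, matchL (inducedSub (evenBlock n q j) H) := by
          refine Finset.sum_le_sum fun j _ => ?_
          by_cases hj : H ∈ bad j
          · rw [Set.indicator_of_mem hj]
            simpa using matchL_nonneg _
          · rw [Set.indicator_of_notMem hj]
            have : ¬ matchL (inducedSub (evenBlock n q j) H) ≤ (1 - δ) * v := hj
            linarith
      _ ≤ matchL H := by
          have := sum_largestMatching_inducedSub_le hd q (evenBlock n q)
            (fun j j' hj i x hx y hy => evenBlock_lt n q hj i x hx y hy) H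
          simp only [matchL]
          exact_mod_cast this
  rw [← Finset.mul_sum, Finset.sum_sub_distrib] at hsum
  simp only [Finset.sum_const, Finset.card_range, nsmul_eq_mul, mul_one] at hsum
  have h1 : (1 - δ) * v * (q - F H) ≤ (1 - δ) * v * ((1 - δ) * q) := by
    refine (hsum.trans hH).trans_eq (by ring)
  have := le_of_mul_le_mul_left h1 (mul_pos (by linarith) hv)
  linarith

theorem exists_forall_two_mul_exp_le {κ β : ℝ} (hκ : 0 < κ) (hβ : 0 < β) :
    ∃ R : ℝ, 0 < R ∧ ∀ x, R ≤ x → 2 * Real.exp (-(κ * x)) ≤ β := by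
  have h : Filter.Tendsto (fun x : ℝ => 2 * Real.exp (-(κ * x))) Filter.atTop (nhds (2 * 0)) :=
    ((Real.tendsto_exp_neg_atTop_nhds_zero).comp
      (Filter.tendsto_id.const_mul_atTop hκ)).const_mul 2
  rw [mul_zero] at h
  obtain ⟨R, hR⟩ := Filter.eventually_atTop.1 (h.eventually (eventually_le_nhds hβ))
  exact ⟨max R 1, by positivity, fun x hx => hR x ((le_max_left _ _).trans hx)⟩

theorem exists_bound_of_isBigO_rpow {g : ℝ → ℝ} {η : ℝ}
    (hg : g =O[Filter.atTop] (fun t : ℝ => t ^ η)) :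
    ∃ C : ℝ, 0 < C ∧ ∀ᶠ t in Filter.atTop, g t ≤ C * t ^ η := by
  obtain ⟨C, hC, h⟩ := hg.exists_pos
  refine ⟨C, hC, ?_⟩
  filter_upwards [h.bound, Filter.eventually_ge_atTop 0] with t ht ht0
  rw [Real.norm_of_nonneg (Real.rpow_nonneg ht0 η)] at ht
  exact (le_abs_self _).trans ht

/-- The index type `ι` and the hypothesis `hblock` isolate what both kinds of model provide: even
blocks follow the same family of distributions. -/
theorem median_lower_bound {d : ℕ} (hd : 2 ≤ d) {ι : Type} (size : ι → Fin d → ℕ) (T : Set ℝ)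
    (D : ℝ → (k : ι) → Measure (PartiteHypergraph (size k))) {h c lam θ η : ℝ} {g : ℝ → ℝ}
    (hh : 0 < h) (hc : 0 < c) (hη : η ≤ lam / ((d : ℝ) - 1)) (hηθ : η < θ - lam)
    (hg : g =O[Filter.atTop] (fun t : ℝ => t ^ η))
    (hprob : ∀ t ∈ T, ∀ k, IsProbabilityMeasure (D t k))
    (hconc : ∀ t ∈ T, ∀ k, HasConcentrationConstant (D t k) h)
    (hblock : ∀ t ∈ T, ∀ k, ∀ q : ℕ, 0 < q → ∃ k', (∀ i, size k' i = size k i / q) ∧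
      ∀ j < q, ∀ x : ℝ, (D t k).real {H | matchL (inducedSub (evenBlock (size k) q j) H) ≤ x} =
        (D t k').real {H | matchL H ≤ x})
    (hmed : AdmitsApproxMedian size T D c lam θ) {ε : ℝ} (hε : 0 < ε) :
    ∃ t₀ A : ℝ, 0 < t₀ ∧ 0 < A ∧ ∀ t ∈ T, t₀ ≤ t → ∀ k,
      t ^ lam * A ≤ geomMean (size k) → sizeSum (size k) ≤ g t * geomMean (size k) →
      ∀ med, IsMedianOf (D t k) matchL med →
        (1 - ε) * (c * geomMean (size k) / t ^ lam) ≤ med := by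
  obtain ⟨C, hC, hgC⟩ := exists_bound_of_isBigO_rpow hg
  obtain ⟨δ, hδdef⟩ : ∃ δ, δ = min ε 1 / 4 := ⟨_, rfl⟩
  have hδ : 0 < δ := by rw [hδdef]; positivity
  have hδ1 : δ ≤ 1 / 4 := by
    have := min_le_right ε 1
    linarith
  have hδε : 4 * δ ≤ ε := by
    have := min_le_left ε 1
    linarith
  obtain ⟨a, b, t', ha, hb, ht', hab⟩ := hmed δ hδ
  -- Half of the available gap: one `t ^ γ` lifts the blocks above the scale `t ^ lam`, the other
  -- pays for the constants in `S * b ≤ t ^ θ`.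
  obtain ⟨γ, hγdef⟩ : ∃ γ, γ = (θ - lam - η) / 2 := ⟨_, rfl⟩
  have hγ : 0 < γ := by linarith
  obtain ⟨R, hR, hRexp⟩ := exists_forall_two_mul_exp_le (κ := h * δ ^ 2 * c / 4) (β := δ / 3)
    (by positivity) (by positivity)
  have hev := (hgC.and (Filter.eventually_ge_atTop (max 1 t'))).and
    ((tendsto_rpow_atTop hγ).eventually_ge_atTop
      (max (max (C ^ (d - 1) / δ) (2 * a)) (max (2 * b * C) R)))
  obtain ⟨t₁, ht₁⟩ := Filter.eventually_atTop.1 hev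
  refine ⟨max t₁ 1, a, by positivity, ha, ?_⟩
  intro t htT htt k hNA hSg med hmedk
  obtain ⟨⟨hgt, htmax⟩, hu⟩ := ht₁ t ((le_max_left _ _).trans htt)
  have ht1 : 1 ≤ t := (le_max_left _ _).trans htmax
  have htt' : t' ≤ t := (le_max_right _ _).trans htmax
  have hu1 : C ^ (d - 1) / δ ≤ t ^ γ := (le_max_left _ _).trans ((le_max_left _ _).trans hu)
  have hu2 : 2 * a ≤ t ^ γ := (le_max_right _ _).trans ((le_max_left _ _).trans hu)
  have hu3 : 2 * b * C ≤ t ^ γ := (le_max_left _ _).trans ((le_max_right _ _).trans hu)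
  have hu4 : R ≤ t ^ γ := (le_max_right _ _).trans ((le_max_right _ _).trans hu)
  have ht0 : 0 < t := by linarith
  have hl0 : 0 < t ^ lam := Real.rpow_pos_of_pos ht0 _
  have hη0 : 0 < t ^ η := Real.rpow_pos_of_pos ht0 _
  have hτ0 : 0 < t ^ (lam + γ) := Real.rpow_pos_of_pos ht0 _
  have hτ : t ^ (lam + γ) = t ^ lam * t ^ γ := Real.rpow_add ht0 _ _
  have hθ : t ^ θ = t ^ η * t ^ (lam + γ) * t ^ γ := by
    rw [← Real.rpow_add ht0, ← Real.rpow_add ht0]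
    congr 1
    rw [hγdef]
    ring
  have hN0 : 0 < geomMean (size k) := (by positivity : 0 < t ^ lam * a).trans_le hNA
  have hS : sizeSum (size k) ≤ C * t ^ η * geomMean (size k) :=
    hSg.trans (mul_le_mul_of_nonneg_right hgt hN0.le)
  have hX0 : 0 < c * geomMean (size k) / t ^ lam := by positivity
  have := hprob t htT k
  rcases le_total (geomMean (size k)) (t ^ (lam + γ)) with hcase | hcase
  · have hSb : sizeSum (size k) * b ≤ t ^ θ := by
      calc sizeSum (size k) * b ≤ C * t ^ η * t ^ (lam + γ) * b := by
            refine mul_le_mul_of_nonneg_right (hS.trans ?_) hb.le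
            gcongr
        _ = t ^ η * t ^ (lam + γ) * (b * C) := by ring
        _ ≤ t ^ η * t ^ (lam + γ) * t ^ γ := by
            refine mul_le_mul_of_nonneg_left ?_ (by positivity)
            nlinarith [mul_pos hb hC]
        _ = t ^ θ := hθ.symm
    refine le_trans ?_ (hab t htT htt' k (by linarith) hSb med hmedk).1
    exact mul_le_mul_of_nonneg_right (by linarith) hX0.le
  · obtain ⟨q, hq, hq1, hq2⟩ := exists_div_mem_Icc hτ0 hcase
    have hq' : (0 : ℝ) < q := Nat.cast_pos.2 hq
    obtain ⟨k', hk', hk'b⟩ := hblock t htT k q hq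
    have := hprob t htT k'
    have hclass : ∀ i, 1 ≤ δ * ((size k i : ℝ) / q) := fun i => by
      have h1 := rpow_div_le_class_size hd ht1 hη hC hq hS hq1 i
      have h2 : 1 / δ ≤ t ^ γ / C ^ (d - 1) := by
        rw [le_div_iff₀ (by positivity)]
        refine le_trans (le_of_eq ?_) hu1
        ring
      have h3 := h2.trans h1
      rw [div_le_iff₀ hδ] at h3
      linarith
    have hlow : ∀ i, (1 - δ) / q * (size k i : ℝ) ≤ size k' i := fun i => by
      have h1 : (size k i : ℝ) / q < (size k' i : ℝ) + 1 := by
        rw [hk' i, div_lt_iff₀ hq']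
        have := Nat.lt_div_mul_add (a := size k i) hq
        have h2 : size k i < (size k i / q + 1) * q := by rw [add_mul, one_mul]; exact this
        exact_mod_cast h2
      have h2 : (1 - δ) / q * (size k i : ℝ) = (size k i : ℝ) / q - δ * ((size k i : ℝ) / q) := by
        ring
      linarith [hclass i]
    have hN' : (1 - δ) / q * geomMean (size k) ≤ geomMean (size k') :=
      mul_geomMean_le (by omega) (div_nonneg (by linarith) hq'.le) hlow
    have hNq : (1 - δ) / q * geomMean (size k) = (1 - δ) * (geomMean (size k) / q) := by ring
    have hN'a : a * t ^ lam ≤ geomMean (size k') := by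
      rw [hNq] at hN'
      have : 1 / 2 * (t ^ lam * (2 * a)) ≤ (1 - δ) * (geomMean (size k) / q) := by
        refine mul_le_mul (by linarith) (le_trans ?_ hq1) (by positivity) (by linarith)
        rw [hτ]
        exact mul_le_mul_of_nonneg_left hu2 hl0.le
      linarith
    have hS' : sizeSum (size k') * b ≤ t ^ θ := by
      have h1 : sizeSum (size k') ≤ sizeSum (size k) / q := by
        rw [sizeSum, sizeSum, Finset.sum_div]
        refine Finset.sum_le_sum fun i _ => ?_
        rw [hk' i]
        exact Nat.cast_div_le
      have h2 : sizeSum (size k) / q ≤ C * t ^ η * (2 * t ^ (lam + γ)) := by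
        calc sizeSum (size k) / q ≤ C * t ^ η * geomMean (size k) / q := by gcongr
          _ = C * t ^ η * (geomMean (size k) / q) := by ring
          _ ≤ _ := by gcongr
      calc sizeSum (size k') * b ≤ C * t ^ η * (2 * t ^ (lam + γ)) * b :=
            mul_le_mul_of_nonneg_right (h1.trans h2) hb.le
        _ = t ^ η * t ^ (lam + γ) * (2 * b * C) := by ring
        _ ≤ t ^ η * t ^ (lam + γ) * t ^ γ := mul_le_mul_of_nonneg_left hu3 (by positivity)
        _ = t ^ θ := hθ.symm
    have hY : c * t ^ γ ≤ c * geomMean (size k) / t ^ lam / q := by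
      rw [hτ] at hq1
      calc c * t ^ γ = c * (t ^ lam * t ^ γ) / t ^ lam := by field_simp
        _ ≤ c * (geomMean (size k) / q) / t ^ lam := by gcongr
        _ = _ := by ring
    have hcu : 0 < c * t ^ γ := by positivity
    have hmed' : ∀ m, IsMedianOf (D t k') matchL m →
        (1 - δ) ^ 2 * (c * geomMean (size k) / t ^ lam / q) ≤ m := fun m hm => by
      refine le_trans ?_ (hab t htT htt' k' hN'a hS' m hm).1
      calc (1 - δ) ^ 2 * (c * geomMean (size k) / t ^ lam / q)
          = (1 - δ) * (c * ((1 - δ) / q * geomMean (size k)) / t ^ lam) := by ring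
        _ ≤ _ := mul_le_mul_of_nonneg_left (by gcongr) (by linarith)
    have hv : c * t ^ γ / 4 ≤ (1 - δ) ^ 2 * (c * geomMean (size k) / t ^ lam / q) := by
      have : (1 : ℝ) / 4 ≤ (1 - δ) ^ 2 := by nlinarith
      calc c * t ^ γ / 4 = 1 / 4 * (c * t ^ γ) := by ring
        _ ≤ _ := mul_le_mul this hY hcu.le (by positivity)
    have hfin := le_median_of_blocks (by omega) (hconc t htT k') hh hq hδ (by linarith)
      (by linarith) hk'b hmed' ?_ hmedk
    · refine le_trans ?_ hfin
      -- Rounding and the approximate median lose one factor `1 - δ` each, the block argument two;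
      -- Bernoulli's inequality turns the product into `1 - 4 * δ`.
      have h1 : (1 - δ) ^ 2 * (q * ((1 - δ) ^ 2 * (c * geomMean (size k) / t ^ lam / q))) =
          (1 - δ) ^ 4 * (c * geomMean (size k) / t ^ lam) := by
        field_simp
      rw [h1]
      refine mul_le_mul_of_nonneg_right ?_ hX0.le
      have := one_add_mul_le_pow (a := -δ) (by linarith) 4
      rw [← sub_eq_add_neg] at this
      push_cast at this
      linarith
    · refine le_trans ?_ (hRexp (t ^ γ) hu4)
      have : h * δ ^ 2 * c / 4 * t ^ γ ≤
          h * δ ^ 2 * ((1 - δ) ^ 2 * (c * geomMean (size k) / t ^ lam / q)) := by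
        calc h * δ ^ 2 * c / 4 * t ^ γ = h * δ ^ 2 * (c * t ^ γ / 4) := by ring
          _ ≤ _ := mul_le_mul_of_nonneg_left hv (by positivity)
      gcongr

/-! ### Upper bound on the medians -/

/-- The `j`-th of the intervals into which the nodes `s i` cut the `i`-th colour class. -/
def chunkBox {d : ℕ} {n : Fin d → ℕ} (s : (i : Fin d) → Finset (Fin (n i))) (j : ℕ) (i : Fin d) :
    Finset (Fin (n i)) :=
  Finset.univ.filter fun x => ((s i).filter fun y => y ≤ x).card = j + 1

theorem mem_chunkBox {d : ℕ} {n : Fin d → ℕ} {s : (i : Fin d) → Finset (Fin (n i))} {j : ℕ}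
    {i : Fin d} {x : Fin (n i)} :
    x ∈ chunkBox s j i ↔ ((s i).filter fun y => y ≤ x).card = j + 1 := by
  simp [chunkBox]

theorem disjoint_chunkBox {d : ℕ} {n : Fin d → ℕ} (s : (i : Fin d) → Finset (Fin (n i)))
    {j j' : ℕ} (hj : j ≠ j') (i : Fin d) : Disjoint (chunkBox s j i) (chunkBox s j' i) := by
  rw [Finset.disjoint_left]
  intro x hx hx'
  rw [mem_chunkBox] at hx hx'
  omega

/-- The cuts are the nodes of edges `0, l, 2 * l, …` of a longest chain. Box `j` holds the nodes
with exactly `j + 1` cuts at or below them, hence edges `j * l` to `j * l + l - 1`; nodes before the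
first cut are discarded. -/
theorem exists_chunkBox {d : ℕ} (hd : 0 < d) {n : Fin d → ℕ} {q l : ℕ} (hl : 0 < l)
    {H : PartiteHypergraph n} (hH : q * l ≤ largestMatching H) :
    ∃ s : (i : Fin d) → Finset (Fin (n i)), (∀ i, s i ∈ Finset.powersetCard q Finset.univ) ∧
      ∀ j < q, l ≤ largestMatching (inducedSub (chunkBox s j) H) := by
  classical
  obtain ⟨E, hE, hlt⟩ := (le_largestMatching_iff hd H _).1 hH
  have hmono : ∀ i, StrictMono fun k => E k i := fun i k k' hk => hlt k k' hk i
  have hidx : ∀ j k : ℕ, j < q → k < l → j * l + k < q * l := fun j k hj hk => by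
    have := Nat.mul_le_mul_right l hj
    rw [Nat.succ_mul] at this
    omega
  let p : (i : Fin d) → Fin q → Fin (n i) := fun i j => E ⟨j * l + 0, hidx j 0 j.2 hl⟩ i
  have hp : ∀ i, Function.Injective (p i) := fun i j j' hjj => by
    have h1 := Fin.mk.inj_iff.1 ((hmono i).injective hjj)
    exact Fin.ext (Nat.eq_of_mul_eq_mul_right hl (by simpa using h1))
  refine ⟨fun i => Finset.univ.image (p i), fun i => ?_, fun j hj => ?_⟩
  · rw [Finset.mem_powersetCard]
    refine ⟨Finset.subset_univ _, ?_⟩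
    rw [Finset.card_image_of_injective _ (hp i), Finset.card_univ, Fintype.card_fin]
  · rw [le_largestMatching_inducedSub_iff hd]
    refine ⟨fun k => E ⟨j * l + k, hidx j k hj k.2⟩, fun k => ⟨hE _, fun i => ?_⟩,
      fun k k' hk i => hlt _ _ (Fin.lt_def.2 (Nat.add_lt_add_left hk _)) i⟩
    rw [mem_chunkBox, Finset.filter_image, Finset.card_image_of_injective _ (hp i)]
    have : (Finset.univ.filter fun j' : Fin q => p i j' ≤ E ⟨j * l + k, hidx j k hj k.2⟩ i) =
        Finset.Iic ⟨j, hj⟩ := by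
      ext j'
      rw [Finset.mem_filter, Finset.mem_Iic]
      simp only [Finset.mem_univ, true_and, p]
      rw [(hmono i).le_iff_le, Fin.le_def, Fin.le_def]
      change (j' : ℕ) * l + 0 ≤ j * l + k ↔ (j' : ℕ) ≤ j
      constructor
      · intro h
        by_contra! hlt
        have h1 := Nat.mul_le_mul_right l hlt
        rw [Nat.succ_mul] at h1
        have := k.2
        omega
      · intro h
        have := Nat.mul_le_mul_right l h
        omega
    rw [this, Fin.card_Iic]

/-- Independence of two blocks suffices for many: the union of the boxes already treated is itself a
block, disjoint from the next box. -/
theorem measureReal_forall_le_pow {d : ℕ} (hd : 0 < d) {n : Fin d → ℕ}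
    {μ : Measure (PartiteHypergraph n)} [IsProbabilityMeasure μ]
    (hindep : ∀ A B : (i : Fin d) → Finset (Fin (n i)), (∀ i, Disjoint (A i) (B i)) →
      IndepFun (inducedSub A) (inducedSub B) μ)
    (A : ℕ → (i : Fin d) → Finset (Fin (n i)))
    (hA : ∀ j j', j ≠ j' → ∀ i, Disjoint (A j i) (A j' i)) {l : ℕ} {p : ℝ} (hp : 0 ≤ p)
    (J : Finset ℕ)
    (hJ : ∀ j ∈ J, μ.real {H | l ≤ largestMatching (inducedSub (A j) H)} ≤ p) :
    μ.real {H | ∀ j ∈ J, l ≤ largestMatching (inducedSub (A j) H)} ≤ p ^ J.card := by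
  classical
  induction J using Finset.induction_on with
  | empty => simp
  | insert j J hj ih =>
    let U : (i : Fin d) → Finset (Fin (n i)) := fun i => J.biUnion fun j' => A j' i
    let F : Set (PartiteHypergraph n) :=
      {H | ∀ j' ∈ J, l ≤ largestMatching (inducedSub (A j') H)}
    -- `F` depends only on the hypergraph induced on `U`.
    have hF : F = inducedSub U ⁻¹' (inducedSub U '' F) := by
      refine Set.Subset.antisymm (Set.subset_preimage_image _ _) ?_
      rintro H ⟨H', hH', hHH⟩ j' hj'
      rw [← largestMatching_inducedSub_congr hd (A := U)
        (fun i => Finset.subset_biUnion_of_mem (fun j' => A j' i) hj') hHH]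
      exact hH' j' hj'
    have hset : {H : PartiteHypergraph n |
        ∀ j' ∈ insert j J, l ≤ largestMatching (inducedSub (A j') H)} =
        inducedSub (A j) ⁻¹' {H | l ≤ largestMatching H} ∩
          inducedSub U ⁻¹' (inducedSub U '' F) := by
      rw [← hF]
      ext H
      exact Finset.forall_mem_insert _ _ _
    have hdisj : ∀ i, Disjoint (A j i) (U i) := fun i => by
      rw [Finset.disjoint_biUnion_right]
      intro j' hj'
      exact hA j j' (fun h => hj (h ▸ hj')) i
    rw [hset, measureReal_def, (hindep _ _ hdisj).measure_inter_preimage_eq_mul _ _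
      (Set.toFinite _).measurableSet (Set.toFinite _).measurableSet, ENNReal.toReal_mul, ← hF,
      Finset.card_insert_of_notMem hj, pow_succ']
    exact mul_le_mul (hJ j (Finset.mem_insert_self _ _))
      (ih fun j' hj' => hJ j' (Finset.mem_insert_of_mem hj')) ENNReal.toReal_nonneg hp

theorem IsRandomModel.real_inducedSub {d : ℕ}
    {D : (n : Fin d → ℕ) → Measure (PartiteHypergraph n)} (hD : IsRandomModel D) (n : Fin d → ℕ)
    (A : (i : Fin d) → Finset (Fin (n i))) {m : Fin d → ℕ} (hA : ∀ i, (A i).card = m i)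
    (P : ℕ → Prop) : (D n).real {H | P (largestMatching (inducedSub A H))} =
      (D m).real {H | P (largestMatching H)} := by
  obtain rfl : (fun i => (A i).card) = m := funext hA
  rw [← hD.monotone n A, measureReal_def, measureReal_def,
    Measure.map_apply (measurable_of_finite _) (Set.toFinite _).measurableSet]
  rfl

/-- The smaller random hypergraph has the law of an induced part of the larger one, and `L` does not
grow under restriction. -/
theorem IsRandomModel.real_le_real {d : ℕ} (hd : 0 < d)
    {D : (n : Fin d → ℕ) → Measure (PartiteHypergraph n)} (hD : IsRandomModel D)
    {m m' : Fin d → ℕ} (hm : ∀ i, m i ≤ m' i) (l : ℕ) :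
    (D m).real {H | l ≤ largestMatching H} ≤ (D m').real {H | l ≤ largestMatching H} := by
  have := hD.prob m'
  rw [← hD.real_inducedSub m' (fun i => Finset.univ.map (Fin.castLEEmb (hm i))) (by simp)
    (fun x => l ≤ x)]
  exact measureReal_mono fun H hH => le_trans hH (largestMatching_inducedSub_le hd _ H)

theorem choose_le_exp_mul_div_pow (n q : ℕ) (hq : 0 < q) :
    (n.choose q : ℝ) ≤ (Real.exp 1 * (n / q)) ^ q := by
  have hq' : (0 : ℝ) < q := Nat.cast_pos.2 hq
  have h1 := Nat.choose_le_pow_div (α := ℝ) q n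
  have h2 := Real.pow_div_factorial_le_exp (q : ℝ) hq'.le q
  calc (n.choose q : ℝ) ≤ (n : ℝ) ^ q / q.factorial := h1
    _ = ((n : ℝ) / q) ^ q * ((q : ℝ) ^ q / q.factorial) := by
      rw [div_pow]
      field_simp
    _ ≤ ((n : ℝ) / q) ^ q * Real.exp q := by gcongr
    _ = _ := by rw [mul_pow, mul_comm, ← Real.exp_nat_mul, mul_one]

theorem card_pi_powersetCard_le {d : ℕ} (hd : 0 < d) (n : Fin d → ℕ) {q : ℕ} (hq : 0 < q) :
    ((Fintype.piFinset fun i => Finset.powersetCard q (Finset.univ : Finset (Fin (n i)))).card : ℝ)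
      ≤ ((Real.exp 1 * (geomMean n / q)) ^ d) ^ q := by
  have hq' : (0 : ℝ) < q := Nat.cast_pos.2 hq
  rw [Fintype.card_piFinset]
  push_cast
  simp only [Finset.card_powersetCard, Finset.card_univ, Fintype.card_fin]
  calc ∏ i, ((n i).choose q : ℝ) ≤ ∏ i, (Real.exp 1 * ((n i : ℝ) / q)) ^ q :=
        Finset.prod_le_prod (fun _ _ => Nat.cast_nonneg _)
          fun i _ => choose_le_exp_mul_div_pow _ _ hq
    _ = _ := by
      rw [Finset.prod_pow, Finset.prod_mul_distrib, Finset.prod_div_distrib, ← geomMean_pow hd,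
        Finset.prod_const, Finset.prod_const, Finset.card_univ, Fintype.card_fin]
      simp only [mul_pow, div_pow]

/-- Most boxes of a partition into `q` boxes are not much larger than the average. -/
theorem le_card_filter_sum_div_le {d : ℕ} (hd : 0 < d) {n : Fin d → ℕ} (hn : ∀ i, 0 < n i) {q : ℕ}
    (A : ℕ → (i : Fin d) → Finset (Fin (n i)))
    (hA : ∀ j j', j ≠ j' → ∀ i, Disjoint (A j i) (A j' i)) {δ : ℝ} (hδ : 0 < δ) (hδ1 : δ ≤ 1) :
    q * (δ / 2) ≤ (((Finset.range q).filter fun j =>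
      ∑ i, ((A j i).card : ℝ) / n i * q ≤ d * (1 + δ)).card : ℝ) := by
  classical
  have hd' : (0 : ℝ) < d := Nat.cast_pos.2 hd
  set G := (Finset.range q).filter fun j => ∑ i, ((A j i).card : ℝ) / n i * q ≤ d * (1 + δ)
    with hG
  set B := (Finset.range q).filter fun j => ¬ ∑ i, ((A j i).card : ℝ) / n i * q ≤ d * (1 + δ)
    with hB
  have hGB : (G.card : ℝ) + B.card = q := by
    have := Finset.card_filter_add_card_filter_not (s := Finset.range q)
      fun j => ∑ i, ((A j i).card : ℝ) / n i * q ≤ d * (1 + δ)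
    rw [Finset.card_range] at this
    exact_mod_cast this
  have hcol : ∀ i, ∑ j ∈ Finset.range q, ((A j i).card : ℝ) / n i ≤ 1 := fun i => by
    rw [← Finset.sum_div, div_le_one (by exact_mod_cast hn i)]
    have h1 : ∑ j ∈ Finset.range q, (A j i).card = ((Finset.range q).biUnion fun j => A j i).card :=
      (Finset.card_biUnion fun j _ j' _ hj => hA j j' hj i).symm
    have h2 := Finset.card_le_univ ((Finset.range q).biUnion fun j => A j i)
    rw [← h1, Fintype.card_fin] at h2
    exact_mod_cast h2
  have htot : ∑ j ∈ Finset.range q, ∑ i, ((A j i).card : ℝ) / n i * q ≤ d * q := by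
    rw [Finset.sum_comm]
    calc ∑ i, ∑ j ∈ Finset.range q, ((A j i).card : ℝ) / n i * q ≤ ∑ i : Fin d, (q : ℝ) :=
          Finset.sum_le_sum fun i _ => by
            rw [← Finset.sum_mul]
            exact mul_le_of_le_one_left (Nat.cast_nonneg _) (hcol i)
      _ = _ := by simp
  -- Markov's inequality: disjointness bounds the total of the rescaled ratio sums by `d * q`, so at
  -- most `q / (1 + δ)` boxes are too large.
  have hbad : (B.card : ℝ) * (d * (1 + δ)) ≤ d * q := by
    calc (B.card : ℝ) * (d * (1 + δ)) = ∑ j ∈ B, (d * (1 + δ) : ℝ) := by simp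
      _ ≤ ∑ j ∈ B, ∑ i, ((A j i).card : ℝ) / n i * q :=
          Finset.sum_le_sum fun j hj => (not_le.1 (Finset.mem_filter.1 hj).2).le
      _ ≤ ∑ j ∈ Finset.range q, ∑ i, ((A j i).card : ℝ) / n i * q :=
          Finset.sum_le_sum_of_subset_of_nonneg (Finset.filter_subset _ _)
            fun j _ _ => Finset.sum_nonneg fun i _ => by positivity
      _ ≤ _ := htot
  have hbad' : (B.card : ℝ) * (1 + δ) ≤ q := by
    refine le_of_mul_le_mul_left (le_trans (le_of_eq ?_) hbad) hd'
    ring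
  have hB0 : (0 : ℝ) ≤ B.card := Nat.cast_nonneg _
  have hG0 : (0 : ℝ) ≤ G.card := Nat.cast_nonneg _
  nlinarith

/-- Union bound over the cuts. For each choice at least `q * (δ / 2)` boxes satisfy the size bound,
and their independent events contribute a factor `p` each; the others are ignored. -/
theorem IsRandomModel.real_mul_le_largestMatching_le {d : ℕ} (hd : 0 < d)
    {D : (n : Fin d → ℕ) → Measure (PartiteHypergraph n)} (hD : IsRandomModel D) {n : Fin d → ℕ}
    (hn : ∀ i, 0 < n i) {q l : ℕ} (hq : 0 < q) (hl : 0 < l) {δ p : ℝ} (hδ : 0 < δ) (hδ1 : δ ≤ 1)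
    (hp : 0 < p) (hp1 : p ≤ 1)
    (hbox : ∀ m : Fin d → ℕ, ∑ i, (m i : ℝ) / n i * q ≤ d * (1 + δ) →
      (D m).real {H | l ≤ largestMatching H} ≤ p) :
    (D n).real {H | q * l ≤ largestMatching H} ≤
      ((Real.exp 1 * (geomMean n / q)) ^ d * p ^ (δ / 2)) ^ q := by
  classical
  have := hD.prob n
  set S := Fintype.piFinset fun i => Finset.powersetCard q (Finset.univ : Finset (Fin (n i)))
    with hS
  have hone : ∀ s ∈ S, (D n).real
      {H | ∀ j < q, l ≤ largestMatching (inducedSub (chunkBox s j) H)} ≤ (p ^ (δ / 2)) ^ q := by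
    intro s _
    have hdis : ∀ j j', j ≠ j' → ∀ i, Disjoint (chunkBox s j i) (chunkBox s j' i) :=
      fun j j' hj i => disjoint_chunkBox s hj i
    set J := (Finset.range q).filter fun j =>
      ∑ i, ((chunkBox s j i).card : ℝ) / n i * q ≤ d * (1 + δ) with hJ
    have hcard : q * (δ / 2) ≤ (J.card : ℝ) :=
      le_card_filter_sum_div_le hd hn (chunkBox s) hdis hδ hδ1
    refine (measureReal_mono fun H hH => ?_).trans
      ((measureReal_forall_le_pow hd (hD.block_indep n) (chunkBox s) hdis hp.le J (l := l)
        fun j hj => ?_).trans ?_)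
    · exact fun j hj => hH j (Finset.mem_range.1 (Finset.mem_filter.1 hj).1)
    · rw [hD.real_inducedSub n (chunkBox s j) (fun _ => rfl) (fun x => l ≤ x)]
      exact hbox _ (Finset.mem_filter.1 hj).2
    · rw [← Real.rpow_natCast, ← Real.rpow_mul_natCast hp.le]
      exact Real.rpow_le_rpow_of_exponent_ge hp hp1 (by linarith)
  calc (D n).real {H | q * l ≤ largestMatching H}
      ≤ (D n).real (⋃ s ∈ S, {H | ∀ j < q, l ≤ largestMatching (inducedSub (chunkBox s j) H)}) := by
        refine measureReal_mono (fun H hH => ?_) (measure_ne_top _ _)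
        obtain ⟨s, hs, hsl⟩ := exists_chunkBox hd hl hH
        exact Set.mem_biUnion (Fintype.mem_piFinset.2 hs) hsl
    _ ≤ ∑ s ∈ S, (D n).real {H | ∀ j < q, l ≤ largestMatching (inducedSub (chunkBox s j) H)} :=
        measureReal_biUnion_finset_le _ _
    _ ≤ ∑ s ∈ S, (p ^ (δ / 2)) ^ q := Finset.sum_le_sum hone
    _ = S.card * (p ^ (δ / 2)) ^ q := by rw [Finset.sum_const, nsmul_eq_mul]
    _ ≤ ((Real.exp 1 * (geomMean n / q)) ^ d) ^ q * (p ^ (δ / 2)) ^ q :=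
        mul_le_mul_of_nonneg_right (card_pi_powersetCard_le hd n hq) (by positivity)
    _ = _ := (mul_pow _ _ _).symm

/-- Exponential beats polynomial decay. It is used with `u = t ^ γ` and `r = (lam + γ) / γ`, so that
`2 * u ^ r` is the upper bound on `N / q`. -/
theorem exists_forall_pow_mul_exp_rpow_le (d : ℕ) (r : ℝ) {κ β : ℝ} (hκ : 0 < κ) (hβ : 0 < β) :
    ∃ R : ℝ, 0 < R ∧ ∀ u, R ≤ u →
      (Real.exp 1 * (2 * u ^ r)) ^ d * (2 * Real.exp (-(κ * u))) ^ β ≤ 1 / 3 := by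
  have h := (tendsto_rpow_mul_exp_neg_mul_atTop_nhds_zero (r * d) (κ * β) (by positivity)).const_mul
    ((Real.exp 1 * 2) ^ d * 2 ^ β)
  rw [mul_zero] at h
  obtain ⟨R, hR⟩ := Filter.eventually_atTop.1
    (h.eventually (eventually_le_nhds (by norm_num : (0 : ℝ) < 1 / 3)))
  refine ⟨max R 1, by positivity,
    fun u hu => le_trans (le_of_eq ?_) (hR u ((le_max_left _ _).trans hu))⟩
  have hu0 : 0 ≤ u := by linarith [(le_max_right R 1).trans hu]
  rw [Real.mul_rpow zero_le_two (Real.exp_pos _).le, ← Real.exp_mul, mul_pow, mul_pow, mul_pow,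
    ← Real.rpow_mul_natCast hu0]
  rw [show -(κ * u) * β = -(κ * β) * u by ring]
  ring

/-- A box that is not much larger than the average can be enlarged to a box whose class sizes are all
of the average order. -/
theorem exists_enlarged_sizes {d : ℕ} (hd : 2 ≤ d) {n m : Fin d → ℕ} {q : ℕ} {δ : ℝ} (hq : 0 < q)
    (hδ : 0 < δ) (hδ1 : 32 * δ ≤ 1) (hn : ∀ i, 1 ≤ δ * ((n i : ℝ) / q))
    (hm : ∑ i, (m i : ℝ) / n i * q ≤ d * (1 + δ)) :
    ∃ m' : Fin d → ℕ, (∀ i, m i ≤ m' i) ∧ δ / q * geomMean n ≤ geomMean m' ∧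
      geomMean m' ≤ (1 + 3 * δ) / q * geomMean n ∧ sizeSum m' ≤ 4 * d * (sizeSum n / q) := by
  have hd0 : 0 < d := by omega
  have hd1 : (2 : ℝ) ≤ d := by exact_mod_cast hd
  have hq' : (0 : ℝ) < q := Nat.cast_pos.2 hq
  have hn0 : ∀ i, 0 < n i := fun i => by
    rcases Nat.eq_zero_or_pos (n i) with h0 | h0
    · have := hn i
      rw [h0] at this
      norm_num at this
    · exact h0
  have hnr : ∀ i, (0 : ℝ) < n i := fun i => Nat.cast_pos.2 (hn0 i)
  -- Adding a `δ` fraction of the average class size keeps thin or empty boxes from falling below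
  -- the range of the median hypothesis, at the cost of at most `2 * δ` in each ratio.
  obtain ⟨m', hm'def⟩ : ∃ m' : Fin d → ℕ, m' = fun i => m i + ⌈δ * ((n i : ℝ) / q)⌉₊ := ⟨_, rfl⟩
  have hm'val : ∀ i, (m' i : ℝ) = m i + (⌈δ * ((n i : ℝ) / q)⌉₊ : ℝ) := fun i => by
    rw [hm'def]
    push_cast
    rfl
  have hceil : ∀ i, (⌈δ * ((n i : ℝ) / q)⌉₊ : ℝ) ≤ 2 * δ * ((n i : ℝ) / q) := fun i => by
    have := (Nat.ceil_lt_add_one (zero_le_one.trans (hn i))).le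
    linarith [hn i]
  have hlow : ∀ i, δ / q * (n i : ℝ) ≤ m' i := fun i => by
    rw [hm'val]
    have h1 := Nat.le_ceil (δ * ((n i : ℝ) / q))
    have h2 : (0 : ℝ) ≤ m i := Nat.cast_nonneg _
    have h3 : δ / q * (n i : ℝ) = δ * ((n i : ℝ) / q) := by ring
    linarith
  have hratio : ∀ i, (m' i : ℝ) / n i * q ≤ (m i : ℝ) / n i * q + 2 * δ := fun i => by
    rw [hm'val, add_div, add_mul]
    have : (⌈δ * ((n i : ℝ) / q)⌉₊ : ℝ) / n i * q ≤ 2 * δ * ((n i : ℝ) / q) / n i * q := by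
      have := hceil i
      have := hnr i
      gcongr
    refine add_le_add_right (this.trans_eq ?_) _
    have := (hnr i).ne'
    field_simp
  refine ⟨m', fun i => by rw [hm'def]; exact Nat.le_add_right _ _,
    mul_geomMean_le hd0 (by positivity) hlow, geomMean_le_of_sum_div_le hd0 hn0 ?_, ?_⟩
  · have h1 : (∑ i, (m' i : ℝ) / n i) * q ≤ d * (1 + 3 * δ) := by
      rw [Finset.sum_mul]
      calc ∑ i, (m' i : ℝ) / n i * q ≤ ∑ i, ((m i : ℝ) / n i * q + 2 * δ) :=
            Finset.sum_le_sum fun i _ => hratio i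
        _ = ∑ i, (m i : ℝ) / n i * q + d * (2 * δ) := by
            rw [Finset.sum_add_distrib]
            simp
        _ ≤ _ := by linarith
    calc ∑ i, (m' i : ℝ) / n i ≤ d * (1 + 3 * δ) / q := (le_div_iff₀ hq').2 h1
      _ = _ := by ring
  · rw [sizeSum, sizeSum, Finset.sum_div, Finset.mul_sum]
    refine Finset.sum_le_sum fun i _ => ?_
    have h1 : (m i : ℝ) / n i * q ≤ d * (1 + δ) :=
      (Finset.single_le_sum (f := fun i => (m i : ℝ) / n i * q) (fun i _ => by positivity)
        (Finset.mem_univ i)).trans hm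
    have h2 : (m' i : ℝ) / n i * q ≤ 4 * d := by
      have h4 : d * (1 + δ) ≤ (d : ℝ) * 2 := mul_le_mul_of_nonneg_left (by linarith) (by linarith)
      linarith [hratio i]
    have h3 : (m' i : ℝ) = (m' i : ℝ) / n i * q * ((n i : ℝ) / q) := by
      have := (hnr i).ne'
      field_simp
    rw [h3]
    exact mul_le_mul_of_nonneg_right h2 (by positivity)

/-- The box is enlarged into the range of the median hypothesis, which only increases the
probability. The enlarged medians are at most `(1 + ε / 4) * Y`, where `Y` is the average share, and
concentration covers the gap up to `(1 + ε / 2) * Y`. -/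
theorem IsRandomModel.real_le_of_box {d : ℕ} (hd : 2 ≤ d)
    {D : (n : Fin d → ℕ) → Measure (PartiteHypergraph n)} {h c lam θ η γ C a b δ ε t : ℝ}
    (hD : IsRandomModel D) (hh : 0 < h) (hc : 0 < c)
    (hconc : ∀ n, HasConcentrationConstant (D n) h)
    (ha : 0 < a) (hb : 0 < b) (hδ : 0 < δ) (hε : 0 < ε) (hε1 : ε ≤ 1) (hδε : 32 * δ ≤ ε)
    (hC : 0 < C)
    (hmed : ∀ k : Fin d → ℕ, a * t ^ lam ≤ geomMean k → sizeSum k * b ≤ t ^ θ →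
      ∀ med : ℝ, IsMedianOf (D k) matchL med →
        (1 - δ) * (c * geomMean k / t ^ lam) ≤ med ∧ med ≤ (1 + δ) * (c * geomMean k / t ^ lam))
    (ht : 0 < t) {n : Fin d → ℕ} {q : ℕ} (hq : 0 < q) (hn : ∀ i, 1 ≤ δ * ((n i : ℝ) / q))
    (hS : sizeSum n ≤ C * t ^ η * geomMean n)
    (hq1 : t ^ (lam + γ) ≤ geomMean n / q) (hq2 : geomMean n / q ≤ 2 * t ^ (lam + γ))
    (hθ : t ^ θ = t ^ η * t ^ (lam + γ) * t ^ γ)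
    (hu1 : a / δ ≤ t ^ γ) (hu2 : 8 * d * b * C ≤ t ^ γ)
    {m : Fin d → ℕ} (hm : ∑ i, (m i : ℝ) / n i * q ≤ d * (1 + δ)) :
    (D m).real {H | ⌈(1 + ε / 2) * (c * geomMean n / t ^ lam / q)⌉₊ ≤ largestMatching H} ≤
      2 * Real.exp (-(h * c * ε ^ 2 / 32 * t ^ γ)) := by
  have hd0 : 0 < d := by omega
  have hq' : (0 : ℝ) < q := Nat.cast_pos.2 hq
  have hl0 : 0 < t ^ lam := Real.rpow_pos_of_pos ht _
  have hη0 : 0 < t ^ η := Real.rpow_pos_of_pos ht _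
  have hu0 : 0 < t ^ γ := Real.rpow_pos_of_pos ht _
  have hτ0 : 0 < t ^ (lam + γ) := Real.rpow_pos_of_pos ht _
  have hτ : t ^ (lam + γ) = t ^ lam * t ^ γ := Real.rpow_add ht _ _
  obtain ⟨m', hmm', hN'low, hN'up, hSm'⟩ :=
    exists_enlarged_sizes hd hq hδ (by linarith) hn hm
  have hN'a : a * t ^ lam ≤ geomMean m' := by
    refine le_trans ?_ hN'low
    rw [div_le_iff₀ hδ] at hu1
    calc a * t ^ lam ≤ t ^ γ * δ * t ^ lam := by gcongr
      _ = δ * t ^ (lam + γ) := by rw [hτ]; ring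
      _ ≤ δ * (geomMean n / q) := by gcongr
      _ = _ := by ring
  have hS' : sizeSum m' * b ≤ t ^ θ := by
    have h2 : sizeSum n / q ≤ C * t ^ η * (2 * t ^ (lam + γ)) := by
      calc sizeSum n / q ≤ C * t ^ η * geomMean n / q := by gcongr
        _ = C * t ^ η * (geomMean n / q) := by ring
        _ ≤ _ := by gcongr
    calc sizeSum m' * b ≤ 4 * d * (sizeSum n / q) * b := by gcongr
      _ ≤ 4 * d * (C * t ^ η * (2 * t ^ (lam + γ))) * b := by gcongr
      _ = t ^ η * t ^ (lam + γ) * (8 * d * b * C) := by ring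
      _ ≤ t ^ η * t ^ (lam + γ) * t ^ γ := by gcongr
      _ = t ^ θ := hθ.symm
  obtain ⟨Y, hYdef⟩ : ∃ Y, Y = c * geomMean n / t ^ lam / q := ⟨_, rfl⟩
  have hY : c * t ^ γ ≤ Y := by
    rw [hτ] at hq1
    calc c * t ^ γ = c * (t ^ lam * t ^ γ) / t ^ lam := by field_simp
      _ ≤ c * (geomMean n / q) / t ^ lam := by gcongr
      _ = _ := by rw [hYdef]; ring
  have hY0 : 0 < Y := (mul_pos hc hu0).trans_le hY
  have hN'0 : 0 < geomMean m' := (mul_pos ha hl0).trans_le hN'a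
  have hmed' : ∀ med, IsMedianOf (D m') matchL med → 0 < med ∧ med ≤ (1 + ε / 4) * Y := by
    intro med hmd
    obtain ⟨h1, h2⟩ := hmed m' hN'a hS' med hmd
    refine ⟨lt_of_lt_of_le (mul_pos (by linarith) (by positivity)) h1, h2.trans ?_⟩
    calc (1 + δ) * (c * geomMean m' / t ^ lam)
        ≤ (1 + δ) * (c * ((1 + 3 * δ) / q * geomMean n) / t ^ lam) := by gcongr
      _ = (1 + δ) * (1 + 3 * δ) * Y := by rw [hYdef]; ring
      _ ≤ _ := mul_le_mul_of_nonneg_right (by nlinarith) hY0.le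
  have hle : (1 + ε / 4) * Y ≤ (1 + ε / 2) * Y := mul_le_mul_of_nonneg_right (by linarith) hY0.le
  have := hD.prob m'
  rw [← hYdef]
  calc (D m).real {H | ⌈(1 + ε / 2) * Y⌉₊ ≤ largestMatching H}
      ≤ (D m').real {H | ⌈(1 + ε / 2) * Y⌉₊ ≤ largestMatching H} :=
        hD.real_le_real hd0 hmm' _
    _ ≤ (D m').real {H | (1 + ε / 2) * Y ≤ matchL H} :=
        measureReal_mono fun H hH => Nat.ceil_le.1 hH
    _ ≤ 2 * Real.exp (-(h * (((1 + ε / 2) * Y - (1 + ε / 4) * Y) ^ 2 / ((1 + ε / 2) * Y)))) :=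
        (hconc m').real_le_of_forall_median_le hh.le hmed' hle
    _ ≤ _ := by
        have e1 : ((1 + ε / 2) * Y - (1 + ε / 4) * Y) ^ 2 / ((1 + ε / 2) * Y) =
            ε ^ 2 * Y / (16 * (1 + ε / 2)) := by
          field_simp
          ring
        have e2 : ε ^ 2 * (c * t ^ γ) / 32 ≤ ε ^ 2 * Y / (16 * (1 + ε / 2)) :=
          div_le_div₀ (by positivity) (mul_le_mul_of_nonneg_left hY (sq_nonneg ε))
            (by positivity) (by linarith)
        have e3 := mul_le_mul_of_nonneg_left e2 hh.le
        have e4 : h * c * ε ^ 2 / 32 * t ^ γ = h * (ε ^ 2 * (c * t ^ γ) / 32) := by ring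
        rw [e1, e4]
        exact mul_le_mul_of_nonneg_left (Real.exp_le_exp.2 (neg_le_neg e3)) zero_le_two

theorem median_upper_bound {d : ℕ} (hd : 2 ≤ d) (T : Set ℝ)
    (D : ℝ → (n : Fin d → ℕ) → Measure (PartiteHypergraph n)) {h c lam θ η : ℝ} {g : ℝ → ℝ}
    (hh : 0 < h) (hc : 0 < c) (hη : η ≤ lam / ((d : ℝ) - 1)) (hηθ : η < θ - lam)
    (hg : g =O[Filter.atTop] (fun t : ℝ => t ^ η))
    (hD : ∀ t ∈ T, IsRandomModel (D t))
    (hconc : ∀ t ∈ T, ∀ n, HasConcentrationConstant (D t n) h)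
    (hmed : AdmitsApproxMedian (fun n : Fin d → ℕ => n) T D c lam θ) {ε : ℝ} (hε : 0 < ε) :
    ∃ t₀ A : ℝ, 0 < t₀ ∧ 0 < A ∧ ∀ t ∈ T, t₀ ≤ t → ∀ n : Fin d → ℕ,
      t ^ lam * A ≤ geomMean n → sizeSum n ≤ g t * geomMean n →
      ∀ med, IsMedianOf (D t n) matchL med → med ≤ (1 + ε) * (c * geomMean n / t ^ lam) := by
  wlog hε1 : ε ≤ 1 generalizing ε
  · obtain ⟨t₀, A, ht₀, hA, H⟩ := this one_pos le_rfl
    refine ⟨t₀, A, ht₀, hA, fun t htT ht n hN hS med hm => (H t htT ht n hN hS med hm).trans ?_⟩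
    have hX : 0 ≤ c * geomMean n / t ^ lam :=
      div_nonneg (mul_nonneg hc.le (geomMean_nonneg n)) (Real.rpow_nonneg (ht₀.le.trans ht) _)
    exact mul_le_mul_of_nonneg_right (by linarith) hX
  obtain ⟨C, hC, hgC⟩ := exists_bound_of_isBigO_rpow hg
  obtain ⟨δ, hδdef⟩ : ∃ δ, δ = ε / 32 := ⟨_, rfl⟩
  have hδ : 0 < δ := by rw [hδdef]; positivity
  have hδε : 32 * δ ≤ ε := by linarith
  obtain ⟨a, b, t', ha, hb, ht', hab⟩ := hmed δ hδ
  obtain ⟨γ, hγdef⟩ : ∃ γ, γ = (θ - lam - η) / 2 := ⟨_, rfl⟩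
  have hγ : 0 < γ := by linarith
  have hκ : 0 < h * c * ε ^ 2 / 32 := by positivity
  obtain ⟨R, hR, hRexp⟩ := exists_forall_two_mul_exp_le hκ one_pos
  obtain ⟨R', hR', hRpow⟩ := exists_forall_pow_mul_exp_rpow_le d ((lam + γ) / γ) hκ
    (β := δ / 2) (by positivity)
  have hev := (hgC.and (Filter.eventually_ge_atTop (max 1 t'))).and
    ((tendsto_rpow_atTop hγ).eventually_ge_atTop
      (max (max (max (C ^ (d - 1) / δ) (a / δ)) (max (8 * d * b * C) (2 / (ε * c)))) (max R R')))
  obtain ⟨t₁, ht₁⟩ := Filter.eventually_atTop.1 hev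
  refine ⟨max t₁ 1, a, by positivity, ha, ?_⟩
  intro t htT htt n hNA hSg med hmedk
  obtain ⟨⟨hgt, htmax⟩, hu⟩ := ht₁ t ((le_max_left _ _).trans htt)
  simp only [max_le_iff] at hu htmax
  obtain ⟨⟨⟨hu1, hu2⟩, hu3, hu4⟩, hu5, hu6⟩ := hu
  obtain ⟨ht1, htt'⟩ := htmax
  have ht0 : 0 < t := by linarith
  have hl0 : 0 < t ^ lam := Real.rpow_pos_of_pos ht0 _
  have hη0 : 0 < t ^ η := Real.rpow_pos_of_pos ht0 _
  have hτ0 : 0 < t ^ (lam + γ) := Real.rpow_pos_of_pos ht0 _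
  have hu0 : 0 < t ^ γ := Real.rpow_pos_of_pos ht0 _
  have hτ : t ^ (lam + γ) = t ^ lam * t ^ γ := Real.rpow_add ht0 _ _
  have hθ : t ^ θ = t ^ η * t ^ (lam + γ) * t ^ γ := by
    rw [← Real.rpow_add ht0, ← Real.rpow_add ht0]
    congr 1
    rw [hγdef]
    ring
  have hN0 : 0 < geomMean n := (by positivity : 0 < t ^ lam * a).trans_le hNA
  have hS : sizeSum n ≤ C * t ^ η * geomMean n :=
    hSg.trans (mul_le_mul_of_nonneg_right hgt hN0.le)
  have hX0 : 0 < c * geomMean n / t ^ lam := by positivity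
  have hd1 : (1 : ℝ) ≤ d := by exact_mod_cast (by omega : 1 ≤ d)
  have := (hD t htT).prob n
  rcases le_total (geomMean n) (t ^ (lam + γ)) with hcase | hcase
  · have hSb : sizeSum n * b ≤ t ^ θ := by
      calc sizeSum n * b ≤ C * t ^ η * t ^ (lam + γ) * b := by
            refine mul_le_mul_of_nonneg_right (hS.trans ?_) hb.le
            gcongr
        _ = t ^ η * t ^ (lam + γ) * (b * C) := by ring
        _ ≤ t ^ η * t ^ (lam + γ) * t ^ γ := by
            refine mul_le_mul_of_nonneg_left ?_ (by positivity)
            nlinarith [mul_pos hb hC]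
        _ = t ^ θ := hθ.symm
    refine (hab t htT htt' n (by linarith) hSb med hmedk).2.trans ?_
    exact mul_le_mul_of_nonneg_right (by linarith) hX0.le
  · obtain ⟨q, hq, hq1, hq2⟩ := exists_div_mem_Icc hτ0 hcase
    have hq' : (0 : ℝ) < q := Nat.cast_pos.2 hq
    have hclass : ∀ i, 1 ≤ δ * ((n i : ℝ) / q) := fun i => by
      have h1 := rpow_div_le_class_size hd ht1 hη hC hq hS hq1 i
      have h2 : 1 / δ ≤ t ^ γ / C ^ (d - 1) := by
        rw [le_div_iff₀ (by positivity)]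
        refine le_trans (le_of_eq ?_) hu1
        ring
      have h3 := h2.trans h1
      rw [div_le_iff₀ hδ] at h3
      linarith
    have hn0 : ∀ i, 0 < n i := fun i => by
      rcases Nat.eq_zero_or_pos (n i) with h0 | h0
      · have := hclass i
        rw [h0] at this
        norm_num at this
      · exact h0
    obtain ⟨Y, hYdef⟩ : ∃ Y, Y = c * geomMean n / t ^ lam / q := ⟨_, rfl⟩
    have hY : c * t ^ γ ≤ Y := by
      rw [hτ] at hq1
      calc c * t ^ γ = c * (t ^ lam * t ^ γ) / t ^ lam := by field_simp
        _ ≤ c * (geomMean n / q) / t ^ lam := by gcongr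
        _ = _ := by rw [hYdef]; ring
    have hY0 : 0 < Y := (mul_pos hc hu0).trans_le hY
    have hl : 0 < ⌈(1 + ε / 2) * Y⌉₊ := Nat.ceil_pos.2 (by positivity)
    have hmain := (hD t htT).real_mul_le_largestMatching_le (by omega) hn0 hq hl hδ
      (by linarith) (p := 2 * Real.exp (-(h * c * ε ^ 2 / 32 * t ^ γ))) (by positivity)
      (hRexp _ hu5) fun m hm => by
        rw [hYdef]
        exact (hD t htT).real_le_of_box hd hh hc (hconc t htT) ha hb hδ hε hε1 hδε hC
          (hab t htT htt') ht0 hq hclass hS hq1 hq2 hθ hu2 hu3 hm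
    have hbase : (Real.exp 1 * (geomMean n / q)) ^ d *
        (2 * Real.exp (-(h * c * ε ^ 2 / 32 * t ^ γ))) ^ (δ / 2) ≤ 1 / 3 := by
      refine le_trans ?_ (hRpow _ hu6)
      rw [← Real.rpow_mul ht0.le, mul_div_cancel₀ _ hγ.ne']
      gcongr
    have hprob : (D t n).real {H | q * ⌈(1 + ε / 2) * Y⌉₊ ≤ largestMatching H} < 1 / 2 := by
      refine (hmain.trans ((pow_le_pow_left₀ (by positivity) hbase q).trans
        (pow_le_of_le_one (by norm_num) (by norm_num) hq.ne'))).trans_lt (by norm_num)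
    refine (hmedk.lt_of_real_lt (lt_of_le_of_lt (measureReal_mono fun H hH => ?_) hprob)).le
    change (1 + ε) * (c * geomMean n / t ^ lam) ≤ (largestMatching H : ℝ) at hH
    change q * ⌈(1 + ε / 2) * Y⌉₊ ≤ largestMatching H
    have hceil := (Nat.ceil_lt_add_one (by positivity : 0 ≤ (1 + ε / 2) * Y)).le
    -- This makes room for the ceiling: `⌈(1 + ε / 2) * Y⌉₊ ≤ (1 + ε) * Y`.
    have hεY : 1 ≤ ε / 2 * Y := by
      rw [div_le_iff₀ (by positivity)] at hu4
      have h1 : t ^ γ * (ε * c) = 2 * (ε / 2 * (c * t ^ γ)) := by ring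
      have h2 := mul_le_mul_of_nonneg_left hY (by positivity : 0 ≤ ε / 2)
      linarith
    have hXY : c * geomMean n / t ^ lam = q * Y := by
      rw [hYdef]
      field_simp
    rw [hXY] at hH
    have : (q : ℝ) * (⌈(1 + ε / 2) * Y⌉₊ : ℝ) ≤ largestMatching H := by
      refine le_trans ?_ hH
      calc (q : ℝ) * (⌈(1 + ε / 2) * Y⌉₊ : ℝ) ≤ q * ((1 + ε) * Y) := by
            refine mul_le_mul_of_nonneg_left ?_ hq'.le
            linarith
        _ = _ := by ring
    exact_mod_cast this

/-! ### Uniform thresholds and conclusion -/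

/-- The threshold depends only on `h` and `ε`, not on the distribution or the class sizes; this
uniformity lets a single `A` serve all of them. -/
theorem exists_lower_threshold {h ε : ℝ} (hh : 0 < h) (hε : 0 < ε) :
    ∃ R : ℝ, 0 < R ∧ ∀ {d : ℕ} {n : Fin d → ℕ} (μ : Measure (PartiteHypergraph n)) (X : ℝ),
      IsProbabilityMeasure μ → HasConcentrationConstant μ h → R ≤ X →
      (∀ med, IsMedianOf μ matchL med → (1 - min ε 1 / 3) * X ≤ med) →
      (1 - ε) * X ≤ ∫ H, matchL H ∂μ ∧
      (∀ med, IsMedianOf μ matchL med → (1 - ε) * X ≤ med) ∧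
      μ.real {H | matchL H ≤ (1 - ε) * X} ≤ Real.exp (-(1 / 16 * h * ε ^ 2 * X)) := by
  obtain ⟨δ, hδdef⟩ : ∃ δ, δ = min ε 1 / 3 := ⟨_, rfl⟩
  have hδ : 0 < δ := by rw [hδdef]; positivity
  have hδ1 : 3 * δ ≤ 1 := by linarith [min_le_right ε 1]
  have hδε : 3 * δ ≤ ε := by linarith [min_le_left ε 1]
  obtain ⟨R, hR, hRexp⟩ := exists_forall_two_mul_exp_le (κ := h * δ ^ 2 / 2) (by positivity) hδ
  refine ⟨max R (16 * Real.log 2 / (h * ε ^ 2)), by positivity, ?_⟩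
  intro d n μ X hprob hμ hX hm
  rw [← hδdef] at hm
  have hX0 : 0 < X := hR.trans_le ((le_max_left _ _).trans hX)
  have hmε : ∀ r, δ ≤ r → ∀ med, IsMedianOf μ matchL med → (1 - r) * X ≤ med := fun r hr med h =>
    (mul_le_mul_of_nonneg_right (by linarith) hX0.le).trans (hm med h)
  refine ⟨?_, hmε ε (by linarith), lower_tail_of_median hμ hh hX0 hε (hmε _ (by linarith)) ?_⟩
  · refine le_trans ?_ (le_integral_matchL_of_median hμ hh hX0 hδ (by linarith) hm ?_)
    · refine mul_le_mul_of_nonneg_right ?_ hX0.le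
      have := one_add_mul_le_pow (a := -δ) (by linarith) 3
      rw [← sub_eq_add_neg] at this
      push_cast at this
      linarith
    · rw [show h * δ ^ 2 * X / 2 = h * δ ^ 2 / 2 * X by ring]
      exact hRexp X ((le_max_left _ _).trans hX)
  · have := (le_max_right _ _).trans hX
    rw [div_le_iff₀ (by positivity)] at this
    linarith

theorem exists_upper_threshold {h ε : ℝ} (hh : 0 < h) (hε : 0 < ε) :
    ∃ R : ℝ, 0 < R ∧ ∀ {d : ℕ} {n : Fin d → ℕ} (μ : Measure (PartiteHypergraph n)) (X : ℝ),
      IsProbabilityMeasure μ → HasConcentrationConstant μ h → R ≤ X →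
      (∀ med, IsMedianOf μ matchL med → 0 < med ∧ med ≤ (1 + min ε 1 / 4) * X) →
      ∫ H, matchL H ∂μ ≤ (1 + ε) * X ∧
      (∀ med, IsMedianOf μ matchL med → med ≤ (1 + ε) * X) ∧
      μ.real {H | (1 + ε) * X ≤ matchL H} ≤
        Real.exp (-(1 / 16 * h * (ε ^ 2 / (1 + ε)) * X)) := by
  obtain ⟨δ, hδdef⟩ : ∃ δ, δ = min ε 1 / 4 := ⟨_, rfl⟩
  have hδ : 0 < δ := by rw [hδdef]; positivity
  have hδ1 : 4 * δ ≤ 1 := by linarith [min_le_right ε 1]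
  have hδε : 4 * δ ≤ ε := by linarith [min_le_left ε 1]
  refine ⟨max 1 (max (2 * (1 - Real.exp (-(h * (δ / (1 + δ)))))⁻¹ / δ)
    (16 * Real.log 2 / (h * (ε ^ 2 / (1 + ε))))), by positivity, ?_⟩
  intro d n μ X hprob hμ hX hm
  rw [← hδdef] at hm
  simp only [max_le_iff] at hX
  obtain ⟨hX1, hX2, hX3⟩ := hX
  have hX0 : 0 < X := by linarith
  have hmε : ∀ r, δ ≤ r → ∀ med, IsMedianOf μ matchL med → 0 < med ∧ med ≤ (1 + r) * X :=
    fun r hr med h =>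
      ⟨(hm med h).1, (hm med h).2.trans (mul_le_mul_of_nonneg_right (by linarith) hX0.le)⟩
  refine ⟨?_, fun med h => (hmε ε (by linarith) med h).2,
    upper_tail_of_median hμ hh hX0 hε (hmε _ (by linarith)) ?_⟩
  · refine (integral_matchL_le_of_median hμ hh hX0 hδ hm ?_).trans ?_
    · rw [div_le_iff₀ hδ] at hX2
      linarith
    · exact mul_le_mul_of_nonneg_right (by nlinarith) hX0.le
  · rw [div_le_iff₀ (by positivity)] at hX3
    linarith

/-- The lower bounds, simultaneously for random models and for weak random models. -/
theorem lower_bounds {d : ℕ} (hd : 2 ≤ d) {ι : Type} (size : ι → Fin d → ℕ) (T : Set ℝ)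
    (D : ℝ → (k : ι) → Measure (PartiteHypergraph (size k))) {h c lam θ η : ℝ} {g : ℝ → ℝ}
    (hh : 0 < h) (hc : 0 < c) (hη : η ≤ lam / ((d : ℝ) - 1)) (hηθ : η < θ - lam)
    (hg : g =O[Filter.atTop] (fun t : ℝ => t ^ η))
    (hprob : ∀ t ∈ T, ∀ k, IsProbabilityMeasure (D t k))
    (hconc : ∀ t ∈ T, ∀ k, HasConcentrationConstant (D t k) h)
    (hblock : ∀ t ∈ T, ∀ k, ∀ q : ℕ, 0 < q → ∃ k', (∀ i, size k' i = size k i / q) ∧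
      ∀ j < q, ∀ x : ℝ, (D t k).real {H | matchL (inducedSub (evenBlock (size k) q j) H) ≤ x} =
        (D t k').real {H | matchL H ≤ x})
    (hmed : AdmitsApproxMedian size T D c lam θ) {ε : ℝ} (hε : 0 < ε) :
    ∃ t₀ A : ℝ, 0 < t₀ ∧ 0 < A ∧ ∀ t ∈ T, t₀ ≤ t → ∀ k,
      t ^ lam * A ≤ geomMean (size k) → sizeSum (size k) ≤ g t * geomMean (size k) →
      (1 - ε) * (c * geomMean (size k) / t ^ lam) ≤ ∫ H, matchL H ∂(D t k) ∧
      (∀ med, IsMedianOf (D t k) matchL med →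
        (1 - ε) * (c * geomMean (size k) / t ^ lam) ≤ med) ∧
      (D t k).real {H | matchL H ≤ (1 - ε) * (c * geomMean (size k) / t ^ lam)} ≤
        Real.exp (-(1 / 16 * h * ε ^ 2 * (c * geomMean (size k) / t ^ lam))) := by
  obtain ⟨R, hR, hRall⟩ := exists_lower_threshold hh hε
  obtain ⟨t₀, A, ht₀, hA, H⟩ := median_lower_bound hd size T D hh hc hη hηθ hg hprob hconc hblock
    hmed (ε := min ε 1 / 3) (by positivity)
  refine ⟨t₀, max A (R / c), ht₀, by positivity, fun t htT ht k hN hS => ?_⟩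
  have hl : 0 < t ^ lam := Real.rpow_pos_of_pos (ht₀.trans_le ht) _
  refine hRall (D t k) _ (hprob t htT k) (hconc t htT k) ?_ (H t htT ht k ?_ hS)
  · rw [le_div_iff₀ hl]
    have h1 := (mul_le_mul_of_nonneg_left (le_max_right A (R / c)) hl.le).trans hN
    rw [← mul_div_assoc, div_le_iff₀ hc] at h1
    linarith
  · exact (mul_le_mul_of_nonneg_left (le_max_left A (R / c)) hl.le).trans hN

theorem IsRandomModel.exists_evenBlock {d : ℕ}
    {D : (n : Fin d → ℕ) → Measure (PartiteHypergraph n)} (hD : IsRandomModel D) (n : Fin d → ℕ)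
    (q : ℕ) : ∃ n' : Fin d → ℕ, (∀ i, n' i = n i / q) ∧ ∀ j < q, ∀ x : ℝ,
      (D n).real {H | matchL (inducedSub (evenBlock n q j) H) ≤ x} =
        (D n').real {H | matchL H ≤ x} :=
  ⟨fun i => n i / q, fun _ => rfl, fun _ hj x =>
    hD.real_inducedSub n _ (card_evenBlock n hj) fun y => (y : ℝ) ≤ x⟩

/-- With equal classes an even block is the same interval in each class, so weak monotonicity
applies. -/
theorem IsWeakRandomModel.exists_evenBlock {d : ℕ} (hd : 0 < d)
    {D : (n : ℕ) → Measure (PartiteHypergraph (fun _ : Fin d => n))} (hD : IsWeakRandomModel D)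
    (n q : ℕ) : ∃ n' : ℕ, (∀ _ : Fin d, n' = n / q) ∧ ∀ j < q, ∀ x : ℝ,
      (D n).real {H | matchL (inducedSub (evenBlock (fun _ : Fin d => n) q j) H) ≤ x} =
        (D n').real {H | matchL H ≤ x} := by
  refine ⟨n / q, fun _ => rfl, fun j hj x => ?_⟩
  rw [← card_evenBlock (fun _ : Fin d => n) hj ⟨0, hd⟩, ← hD.monotone n, measureReal_def,
    measureReal_def, Measure.map_apply (measurable_of_finite _) (Set.toFinite _).measurableSet]
  rfl

theorem mainTheorem1 :
    ∃ K : ℝ, 0 < K ∧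
    ∀ (d : ℕ), 2 ≤ d →
    ∀ (T : Set ℝ) (h c lam θ η : ℝ) (g : ℝ → ℝ), 0 < h → 0 < c →
      0 ≤ η → η ≤ lam / ((d : ℝ) - 1) → η < θ - lam →
      g =O[Filter.atTop] (fun t : ℝ => t ^ η) →
      -- random hypergraph models
      (∀ D : ℝ → (n : Fin d → ℕ) → Measure (PartiteHypergraph n),
        (∀ t ∈ T, IsRandomModel (D t)) →
        (∀ t ∈ T, ∀ n, HasConcentrationConstant (D t n) h) →
        AdmitsApproxMedian (fun n : Fin d → ℕ => n) T D c lam θ →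
        ∀ ε : ℝ, 0 < ε → ∃ t₀ A : ℝ, 0 < t₀ ∧ 0 < A ∧
          ∀ t ∈ T, t₀ ≤ t → ∀ n : Fin d → ℕ,
            t ^ lam * A ≤ geomMean n → sizeSum n ≤ g t * geomMean n →
            ((1 - ε) * (c * geomMean n / t ^ lam) ≤ ∫ H, matchL H ∂(D t n) ∧
              ∫ H, matchL H ∂(D t n) ≤ (1 + ε) * (c * geomMean n / t ^ lam)) ∧
            (∀ med : ℝ, IsMedianOf (D t n) matchL med →
              (1 - ε) * (c * geomMean n / t ^ lam) ≤ med ∧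
              med ≤ (1 + ε) * (c * geomMean n / t ^ lam)) ∧
            (D t n).real {H | matchL H ≤ (1 - ε) * (c * geomMean n / t ^ lam)} ≤
              Real.exp (-(K * h * ε ^ 2 * (c * geomMean n / t ^ lam))) ∧
            (D t n).real {H | (1 + ε) * (c * geomMean n / t ^ lam) ≤ matchL H} ≤
              Real.exp (-(K * h * (ε ^ 2 / (1 + ε)) * (c * geomMean n / t ^ lam)))) ∧
      -- weak random hypergraph models, with all class sizes equal to `n`
      (∀ D : ℝ → (n : ℕ) → Measure (PartiteHypergraph (fun _ : Fin d => n)),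
        (∀ t ∈ T, IsWeakRandomModel (D t)) →
        (∀ t ∈ T, ∀ n, HasConcentrationConstant (D t n) h) →
        AdmitsApproxMedian (fun (n : ℕ) (_ : Fin d) => n) T D c lam θ →
        ∀ ε : ℝ, 0 < ε → ∃ t₀ A : ℝ, 0 < t₀ ∧ 0 < A ∧
          ∀ t ∈ T, t₀ ≤ t → ∀ n : ℕ,
            t ^ lam * A ≤ geomMean (fun _ : Fin d => n) →
            sizeSum (fun _ : Fin d => n) ≤ g t * geomMean (fun _ : Fin d => n) →
            (1 - ε) * (c * geomMean (fun _ : Fin d => n) / t ^ lam) ≤ ∫ H, matchL H ∂(D t n) ∧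
            (∀ med : ℝ, IsMedianOf (D t n) matchL med →
              (1 - ε) * (c * geomMean (fun _ : Fin d => n) / t ^ lam) ≤ med) ∧
            (D t n).real
                {H | matchL H ≤ (1 - ε) * (c * geomMean (fun _ : Fin d => n) / t ^ lam)} ≤
              Real.exp (-(K * h * ε ^ 2 * (c * geomMean (fun _ : Fin d => n) / t ^ lam)))) := by
  refine ⟨1 / 16, by norm_num, ?_⟩
  intro d hd T h c lam θ η g hh hc _ hη hηθ hg
  refine ⟨fun D hD hconc hmed ε hε => ?_, fun D hD hconc hmed ε hε => ?_⟩
  · obtain ⟨R, hR, hRall⟩ := exists_upper_threshold hh hε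
    obtain ⟨t₁, A₁, ht₁, hA₁, H₁⟩ := lower_bounds hd (fun n : Fin d → ℕ => n) T D hh hc hη hηθ hg
      (fun t htT => (hD t htT).prob) hconc
      (fun t htT n q _ => (hD t htT).exists_evenBlock n q) hmed hε
    obtain ⟨t₂, A₂, ht₂, hA₂, H₂⟩ := median_upper_bound hd T D hh hc hη hηθ hg hD hconc hmed
      (ε := min ε 1 / 4) (by positivity)
    -- Used only for positivity of the medians, which the upper tail requires; the lower bound for
    -- `ε` itself is void when `ε ≥ 1`.
    obtain ⟨t₃, A₃, ht₃, hA₃, H₃⟩ := lower_bounds hd (fun n : Fin d → ℕ => n) T D hh hc hη hηθ hg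
      (fun t htT => (hD t htT).prob) hconc
      (fun t htT n q _ => (hD t htT).exists_evenBlock n q) hmed (ε := 1 / 2) (by norm_num)
    refine ⟨max t₁ (max t₂ t₃), max (max A₁ (R / c)) (max A₂ A₃), by positivity, by positivity,
      fun t htT ht n hN hS => ?_⟩
    simp only [max_le_iff] at ht
    have hl : 0 < t ^ lam := Real.rpow_pos_of_pos (ht₁.trans_le ht.1) _
    have hNA : ∀ B, B ≤ max (max A₁ (R / c)) (max A₂ A₃) → t ^ lam * B ≤ geomMean n :=
      fun B hB => (mul_le_mul_of_nonneg_left hB hl.le).trans hN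
    have hX : R ≤ c * geomMean n / t ^ lam := by
      have h1 := hNA (R / c) ((le_max_right _ _).trans (le_max_left _ _))
      rw [← mul_div_assoc, div_le_iff₀ hc] at h1
      rw [le_div_iff₀ hl]
      linarith
    obtain ⟨ha, hb, hc'⟩ := H₁ t htT ht.1 n (hNA A₁ ((le_max_left _ _).trans (le_max_left _ _))) hS
    obtain ⟨-, hpos, -⟩ := H₃ t htT ht.2.2 n
      (hNA A₃ ((le_max_right _ _).trans (le_max_right _ _))) hS
    have hup := H₂ t htT ht.2.1 n (hNA A₂ ((le_max_left _ _).trans (le_max_right _ _))) hS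
    obtain ⟨ha', hb', hd'⟩ := hRall (D t n) _ ((hD t htT).prob n) (hconc t htT n) hX
      fun med hm => ⟨lt_of_lt_of_le (mul_pos (by norm_num) (hR.trans_le hX)) (hpos med hm),
        hup med hm⟩
    exact ⟨⟨ha, ha'⟩, fun med hm => ⟨hb med hm, hb' med hm⟩, hc', hd'⟩
  · exact lower_bounds hd (fun (n : ℕ) (_ : Fin d) => n) T D hh hc hη hηθ hg
      (fun t htT => (hD t htT).prob) hconc
      (fun t htT n q _ => (hD t htT).exists_evenBlock (by omega) n q) hmed hε
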